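/- \textbf{Improper representation theorem.} Let $T>0$, $H\in(1/2,1)$, let $(\Omega,\mathcal F,\mathbf P)$ be a complete probability space and $\mathbb F=\{\mathcal F_t,\ t\in[0,T]\}$ a filtration on it satisfying the usual conditions (right-continuous, each $\mathcal F_t$ containing all $\mathbf P$-null sets). Adaptedness is understood with respect to $\mathbb F$. Let $G=\{G(t),\ t\in[0,T]\}$ be an adapted, continuous, centered Gaussian process such that (A) there exist $C_1,C_2>0$ such that $C_1|t-s|^{2H}\le \mathbf E|G(t)-G(s)|^2\le C_2|t-s|^{2H}$ for all $s,t\in[0,T]$; (B) $\mathbf E\big(G(t_1)-G(s_1)\big)\big(G(t_2)-G(s_2)\big)\ge 0$ for all $0\le s_1\le t_1\le s_2\le t_2\le T$. Let $\xi$ be a real random variable that is measurable with respect to $\mathcal F_{T-}=\sigma\big(\bigcup_{t<T}\mathcal F_t\big)$ (for instance, any $\mathcal F_T$-measurable random variable if $\mathcal F_T=\mathcal F_{T-}$). Then there exist an adapted process $\psi$ and a number $\alpha\in(1-H,\tfrac12)$ such that, almost surely, $\|\psi\|_{\alpha,t}<\infty$ for every $t\in[0,T)$, the generalized Lebesgue--Stieltjes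 integrals $\int_0^t\psi(s)\,dG(s)$, $t\in[0,T)$, are well defined, and $$\xi=\lim_{t\to T-}\int_0^t\psi(s)\,dG(s).$$ Here, for a measurable function $f$, $$\|f\|_{\alpha,t}=\int_0^t\left(\frac{|f(s)|}{s^\alpha}+\int_0^s\frac{|f(s)-f(z)|}{(s-z)^{1+\alpha}}\,dz\right)ds ,$$ and the integral is taken pathwise as the generalized Lebesgue--Stieltjes integral $$\int_a^b f(x)\,dg(x)=-\int_a^b\big(\mathcal D^{\alpha}_{a+}f\big)(x)\,\big(\mathcal D^{1-\alpha}_{b-}g_{b-}\big)(x)\,dx,\qquad g_{b-}(x)=g(x)-g(b),$$ which is well defined if the integrals in the two derivatives converge absolutely for almost every $x\in(a,b)$, $\mathcal D^{\alpha}_{a+}f\in L_1[a,b]$ and $\mathcal D^{1-\alpha}_{b-}g_{b-}\in L_\infty[a,b]$, where for $x\in(a,b)$ and $\beta\in(0,1)$ $$\big(\mathcal D_{a+}^{\beta}f\big)(x)=\frac1{\Gamma(1-\beta)}\left(\frac{f(x)}{(x-a)^\beta}+\beta\int_a^x\frac{f(x)-f(u)}{(x-u)^{1+\beta}}\,du\right),$$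 $$\big(\mathcal D_{b-}^{\beta}g\big)(x)=\frac1{\Gamma(1-\beta)}\left(\frac{g(x)}{(b-x)^\beta}+\beta\int_x^b\frac{g(x)-g(u)}{(u-x)^{1+\beta}}\,du\right).$$ -/

import Mathlib

open MeasureTheory ProbabilityTheory Set Filter Topology
open scoped ENNReal

noncomputable section

namespace PathwiseIntegral

/-- The left-sided Riemann--Liouville fractional derivative `D_{a+}^α f` on `[a, b]`
(in its Weyl form). -/
def leftDeriv (α a b : ℝ) (f : ℝ → ℝ) : ℝ → ℝ :=
  (Ioo a b).indicator fun x =>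
    (1 / Real.Gamma (1 - α)) *
      (f x / (x - a) ^ α + α * ∫ u in a..x, (f x - f u) / (x - u) ^ (1 + α))

/-- The right-sided Riemann--Liouville fractional derivative `D_{b-}^α g` on `[a, b]`
(in its Weyl form, without the factor `(-1)^α`). -/
def rightDeriv (α a b : ℝ) (g : ℝ → ℝ) : ℝ → ℝ :=
  (Ioo a b).indicator fun x =>
    (1 / Real.Gamma (1 - α)) *
      (g x / (b - x) ^ α + α * ∫ u in x..b, (g x - g u) / (u - x) ^ (1 + α))

/-- The function `g_{b-}(x) = g(x) - g(b)`. -/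
def recenter (b : ℝ) (g : ℝ → ℝ) : ℝ → ℝ := fun x => g x - g b

/-- The generalized Lebesgue--Stieltjes integral `∫_a^b f dg` is well defined with parameter `α`:
the integrals in `D_{a+}^α f` and in `D_{b-}^{1-α} g_{b-}` converge absolutely at almost every
point, `D_{a+}^α f ∈ L₁[a,b]` and `D_{b-}^{1-α} g_{b-} ∈ L_∞[a,b]`. -/
structure GLSIntegrable (α a b : ℝ) (f g : ℝ → ℝ) : Prop where
  left_converges : ∀ᵐ x ∂volume.restrict (Ioo a b),
    IntegrableOn (fun u => (f x - f u) / (x - u) ^ (1 + α)) (Ioo a x)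
  right_converges : ∀ᵐ x ∂volume.restrict (Ioo a b),
    IntegrableOn (fun u => (recenter b g x - recenter b g u) / (u - x) ^ (1 + (1 - α))) (Ioo x b)
  left_memLp : MemLp (leftDeriv α a b f) 1 (volume.restrict (Ioo a b))
  right_memLp : MemLp (rightDeriv (1 - α) a b (recenter b g)) ∞ (volume.restrict (Ioo a b))

/-- The generalized Lebesgue--Stieltjes integral `∫_a^b f dg`.

The usual sign factors `(-1)^α` of the integral and `(-1)^(1-α)` of the right-sided derivative
multiply to `-1`; with this sign the integral of `1` with respect to `g` is `g(b) - g(a)`, and the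
integral agrees with the Riemann--Stieltjes integral for Hölder continuous integrands. -/
def glsIntegral (α a b : ℝ) (f g : ℝ → ℝ) : ℝ :=
  -∫ x in a..b, leftDeriv α a b f x * rightDeriv (1 - α) a b (recenter b g) x

/-- The norm `‖f‖_{α,[a,b]}`, with values in `[0, ∞]`. -/
def fracNorm (α a b : ℝ) (f : ℝ → ℝ) : ℝ≥0∞ :=
  ∫⁻ s in Ioo a b,
    (ENNReal.ofReal (|f s| / (s - a) ^ α) +
      ∫⁻ z in Ioo a s, ENNReal.ofReal (|f s - f z| / (s - z) ^ (1 + α)))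

/-- `‖f‖_{α,[a,b]} < ∞`, where `f` is Lebesgue measurable on `[a, b]`, so that the integrals
defining the norm make sense. -/
def FiniteFracNorm (α a b : ℝ) (f : ℝ → ℝ) : Prop :=
  AEMeasurable f (volume.restrict (Ioo a b)) ∧ fracNorm α a b f < ∞

variable {Ω : Type*} {m : MeasurableSpace Ω}

/-- The usual conditions for a filtration indexed by `[0, T]`: it is right-continuous and each
`𝓕 t` contains all subsets of null sets (in particular the probability space is complete). -/
structure UsualConditions {T : ℝ} (𝓕 : Filtration (Icc (0 : ℝ) T) m) (P : Measure Ω) : Prop where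
  rightContinuous : 𝓕.IsRightContinuous
  null_sets : ∀ (t : Icc (0 : ℝ) T) (s : Set Ω), P s = 0 → MeasurableSet[𝓕 t] s

/-- The σ-algebra `𝓕_{T-}` generated by all `𝓕 t` with `t < T`. -/
abbrev sigmaBeforeEnd {T : ℝ} (𝓕 : Filtration (Icc (0 : ℝ) T) m) : MeasurableSpace Ω :=
  ⨆ (t : Icc (0 : ℝ) T) (_ : (t : ℝ) < T), 𝓕 t

/-- Two-sided power bounds of order `2H` for the incremental variance on `[0, T]`. -/
def ConditionA (H T : ℝ) (G : ℝ → Ω → ℝ) (P : Measure Ω) : Prop :=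
  ∃ C₁ C₂ : ℝ, 0 < C₁ ∧ 0 < C₂ ∧ ∀ s ∈ Icc 0 T, ∀ t ∈ Icc 0 T,
    C₁ * |t - s| ^ (2 * H) ≤ ∫ ω, |G t ω - G s ω| ^ 2 ∂P ∧
      ∫ ω, |G t ω - G s ω| ^ 2 ∂P ≤ C₂ * |t - s| ^ (2 * H)

/-- Non-overlapping increments on `[0, T]` are nonnegatively correlated. -/
def ConditionB (T : ℝ) (G : ℝ → Ω → ℝ) (P : Measure Ω) : Prop :=
  ∀ s₁ t₁ s₂ t₂ : ℝ, 0 ≤ s₁ → s₁ ≤ t₁ → t₁ ≤ s₂ → s₂ ≤ t₂ → t₂ ≤ T →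
    0 ≤ ∫ ω, (G t₁ ω - G s₁ ω) * (G t₂ ω - G s₂ ω) ∂P

end PathwiseIntegral

end

/-! The integral of an adapted step process is a finite sum of increments of `G`, and such sums can
be steered to a prescribed value on an arbitrarily short interval. Along a partition of `[a, b]`,
the left-point sum of `2N (G(u_i) - G(a)) (G(u_{i+1}) - G(u_i))` equals `N (G(u_j) - G(a))²` minus
`N` times the sum of squared increments. Paths are Hölder of an order above `1/2`, so a fine
partition makes the second term negligible. The sum is then almost nonnegative, and its final value
is close to `N (G(b) - G(a))²`, which exceeds any given level with high probability once `N` is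
large, because `G(b) ≠ G(a)` almost surely. Stopping the integrand when the sum first reaches `|Y|`,
and multiplying by the sign of `Y`, gives an integral which ends near an `𝓕 a`-measurable target `Y`
and never leaves a neighbourhood of the segment from `0` to `Y` (`stoppedCoeff_stepIntegral_bound`,
`exists_steering_block`).

Levy's upward theorem gives variables `X n → ξ` measurable at times `t_n` increasing to `T`
(`exists_adapted_approximation`). On `[t_n, t_{n+1}]` the target is `X n` minus the integral
accumulated so far. The failure probabilities are summable, so by Borel–Cantelli all but finitely
many blocks succeed. The accumulated integrals then converge to `ξ`, and the excursions inside the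
blocks tend to zero (`exists_steering_blocks`, `tendsto_of_steering`).

Two analytic facts support this. First, the generalized Lebesgue–Stieltjes integral of an indicator
is the expected increment (`hasGLS_heaviside`); the left derivative of the indicator of `[c, ∞)` is
a multiple of `(x - c)^(-α)`, so this amounts to inverting the right fractional derivative of a
Hölder function (`integral_rightKernel`). Second, Gaussian moments and a dyadic chaining argument
give Hölder paths with a measurable constant (`exists_holder_constant`). -/

noncomputable section

namespace PathwiseIntegral

/-! ### Singular kernels and elementary integrals -/

/-- Global Hölder continuity of a real function, in the form used for the pathwise integral. -/
def HolderBound (C γ : ℝ) (g : ℝ → ℝ) : Prop := ∀ x y, |g x - g y| ≤ C * |x - y| ^ γ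

lemma HolderBound.continuous {C γ : ℝ} {g : ℝ → ℝ} (hγ : 0 < γ) (h : HolderBound C γ g) :
    Continuous g := by
  rw [continuous_iff_continuousAt]
  intro x
  rw [ContinuousAt, tendsto_iff_dist_tendsto_zero]
  have : Tendsto (fun y => C * |y - x| ^ γ) (𝓝 x) (𝓝 0) := by
    have h1 : Continuous fun y : ℝ => C * |y - x| ^ γ := by
      have := hγ.le
      fun_prop (disch := assumption)
    have h2 := h1.tendsto x
    simpa [Real.zero_rpow hγ.ne'] using h2
  refine squeeze_zero (fun _ => dist_nonneg) (fun y => ?_) this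
  rw [Real.dist_eq]
  exact h y x

lemma integrableOn_sub_rpow {x t p : ℝ} (hp : -1 < p) :
    IntegrableOn (fun u => (u - x) ^ p) (Ioo x t) := by
  rcases le_total t x with h | h
  · simp [Ioo_eq_empty_of_le h]
  rw [← intervalIntegrable_iff_integrableOn_Ioo_of_le h]
  have := (intervalIntegral.intervalIntegrable_rpow' (a := 0) (b := t - x) hp).comp_sub_right x
  simpa using this

lemma integral_sub_rpow {x t p : ℝ} (hp : -1 < p) (hxt : x ≤ t) :
    ∫ u in Ioo x t, (u - x) ^ p = (t - x) ^ (p + 1) / (p + 1) := by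
  rw [← integral_Ioc_eq_integral_Ioo, ← intervalIntegral.integral_of_le hxt,
    intervalIntegral.integral_comp_sub_right (fun u => u ^ p) x, sub_self,
    integral_rpow (Or.inl hp), Real.zero_rpow (by linarith), sub_zero]

lemma HolderBound.abs_kernel_le {C γ β : ℝ} {g : ℝ → ℝ} (h : HolderBound C γ g) {x u : ℝ}
    (hxu : x < u) : |(g x - g u) / (u - x) ^ (1 + β)| ≤ C * (u - x) ^ (γ - β - 1) := by
  have h0 : 0 < u - x := sub_pos.2 hxu
  have h1 := h x u
  rw [abs_sub_comm x u, abs_of_pos h0] at h1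
  rw [abs_div, abs_of_pos (Real.rpow_pos_of_pos h0 _), div_le_iff₀ (Real.rpow_pos_of_pos h0 _),
    mul_assoc, ← Real.rpow_add h0]
  rwa [show γ - β - 1 + (1 + β) = γ by ring]

lemma HolderBound.integrableOn_kernel {C γ β : ℝ} {g : ℝ → ℝ} (h : HolderBound C γ g)
    (hγ : 0 < γ) (hβγ : β < γ) (x t : ℝ) :
    IntegrableOn (fun u => (g x - g u) / (u - x) ^ (1 + β)) (Ioo x t) := by
  have hc := h.continuous hγ
  refine Integrable.mono' ((integrableOn_sub_rpow (x := x) (t := t)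
    (p := γ - β - 1) (by linarith)).const_mul C) ?_ ?_
  · apply Measurable.aestronglyMeasurable
    fun_prop
  · refine (ae_restrict_iff' measurableSet_Ioo).2 (ae_of_all _ fun u hu => ?_)
    exact h.abs_kernel_le hu.1

lemma HolderBound.abs_integral_kernel_le {C γ β : ℝ} {g : ℝ → ℝ} (h : HolderBound C γ g)
    (hβγ : β < γ) {x a t : ℝ} (hxa : x ≤ a) (hat : a ≤ t) :
    |∫ u in a..t, (g x - g u) / (u - x) ^ (1 + β)| ≤ C * ((t - x) ^ (γ - β) / (γ - β)) := by
  have hC : 0 ≤ C := by simpa using (abs_nonneg _).trans (h 0 1)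
  have hxt := hxa.trans hat
  have hi : IntegrableOn (fun u => C * (u - x) ^ (γ - β - 1)) (Ioo x t) :=
    (integrableOn_sub_rpow (p := γ - β - 1) (by linarith)).const_mul C
  have h1 : ∫ u in Ioo x t, C * (u - x) ^ (γ - β - 1) = C * ((t - x) ^ (γ - β) / (γ - β)) := by
    rw [integral_const_mul, integral_sub_rpow (by linarith) hxt]
    simp
  rw [intervalIntegral.integral_of_le hat, integral_Ioc_eq_integral_Ioo, ← h1, ← Real.norm_eq_abs]
  refine (norm_integral_le_of_norm_le (hi.mono_set (Ioo_subset_Ioo_left hxa)) ?_).trans ?_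
  · refine (ae_restrict_iff' measurableSet_Ioo).2 (ae_of_all _ fun u hu => ?_)
    exact h.abs_kernel_le (hxa.trans_lt hu.1)
  · refine setIntegral_mono_set hi ?_ (Ioo_subset_Ioo_left hxa).eventuallyLE
    refine (ae_restrict_iff' measurableSet_Ioo).2 (ae_of_all _ fun u hu => ?_)
    have := sub_pos.2 hu.1
    simp only [Pi.zero_apply]
    positivity

/-- `x ↦ (x / (u - x)) ^ β / (β u)` is a primitive of `x ^ (β - 1) / (u - x) ^ (1 + β)`. -/
lemma integral_beta_kernel {β u v : ℝ} (hβ : 0 < β) (hv : 0 < v) (hvu : v < u) :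
    IntegrableOn (fun x => x ^ (β - 1) / (u - x) ^ (1 + β)) (Ioo 0 v) ∧
    ∫ x in Ioo 0 v, x ^ (β - 1) / (u - x) ^ (1 + β) = (v / (u - v)) ^ β / (β * u) := by
  have hu : 0 < u := hv.trans hvu
  have hcont : ContinuousOn (fun x => (x / (u - x)) ^ β / (β * u)) (Icc 0 v) := by
    refine ContinuousOn.div_const (ContinuousOn.rpow_const ?_ fun _ _ => Or.inr hβ.le) _
    refine continuousOn_id.div (by fun_prop) fun x hx => ?_
    have := hx.2
    exact (by linarith : 0 < u - x).ne'
  have hder : ∀ x ∈ Ioo 0 v, HasDerivAt (fun x => (x / (u - x)) ^ β / (β * u))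
      (x ^ (β - 1) / (u - x) ^ (1 + β)) x := by
    intro x hx
    have hx0 : 0 < x := hx.1
    have hux : 0 < u - x := by linarith [hx.2]
    have h1 : HasDerivAt (fun x => x / (u - x)) ((1 * (u - x) - x * (-1)) / (u - x) ^ 2) x :=
      (hasDerivAt_id x).div ((hasDerivAt_id x).const_sub u) hux.ne'
    have h2 := (h1.rpow_const (p := β) (Or.inl (div_pos hx0 hux).ne')).div_const (β * u)
    refine h2.congr_deriv ?_
    rw [Real.div_rpow hx0.le hux.le, Real.rpow_add hux, Real.rpow_sub hux, Real.rpow_one]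
    field_simp
    ring
  have hint : IntegrableOn (fun x => x ^ (β - 1) / (u - x) ^ (1 + β)) (Ioc 0 v) := by
    refine intervalIntegral.integrableOn_deriv_of_nonneg hcont hder fun x hx => ?_
    have hux : 0 < u - x := by linarith [hx.2]
    have := hx.1
    positivity
  refine ⟨hint.mono_set Ioo_subset_Ioc_self, ?_⟩
  rw [← integral_Ioc_eq_integral_Ioo, ← intervalIntegral.integral_of_le hv.le,
    intervalIntegral.integral_eq_sub_of_hasDerivAt_of_le hv.le hcont hder
      ((intervalIntegrable_iff_integrableOn_Ioc_of_le hv.le).2 hint)]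
  simp [Real.zero_rpow hβ.ne']

lemma integral_shifted_rpow {β x a t : ℝ} (hβ : 0 < β) (hxa : x < a) (hat : a ≤ t) :
    ∫ u in a..t, 1 / (u - x) ^ (1 + β) = ((a - x) ^ (-β) - (t - x) ^ (-β)) / β := by
  have h1 : ∀ u ∈ uIcc a t, 1 / (u - x) ^ (1 + β) = (u - x) ^ (-1 - β) := by
    intro u hu
    rw [uIcc_of_le hat] at hu
    have : 0 < u - x := by linarith [hu.1]
    rw [one_div, ← Real.rpow_neg this.le]
    congr 1; ring
  rw [intervalIntegral.integral_congr h1,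
    intervalIntegral.integral_comp_sub_right (fun u => u ^ (-1 - β)) x, integral_rpow]
  · rw [show -1 - β + 1 = -β by ring]
    field_simp
    ring
  · refine Or.inr ⟨by linarith, ?_⟩
    rw [uIcc_of_le (by linarith)]
    intro h
    linarith [h.1]

/-! ### Inversion of the right-sided fractional derivative -/

/-- The numerator of the right-sided derivative, before normalization. -/
def rightKernel (β t : ℝ) (φ : ℝ → ℝ) (x : ℝ) : ℝ :=
  φ x / (t - x) ^ β + β * ∫ u in x..t, (φ x - φ u) / (u - x) ^ (1 + β)

/-- A truncation of `rightKernel`, in which the integration runs over `(1 + ε) x < u < t`. -/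
def truncKernel (β t ε : ℝ) (φ : ℝ → ℝ) (x : ℝ) : ℝ :=
  φ x / (ε * x) ^ β - β * ∫ u in Ioo 0 t, (Ioi ((1 + ε) * x)).indicator
    (fun u => φ u / (u - x) ^ (1 + β)) u

lemma HolderBound.integrableOn_div {C γ t : ℝ} {φ : ℝ → ℝ} (h : HolderBound C γ φ) (hγ : 0 < γ)
    (h0 : φ 0 = 0) : IntegrableOn (fun x => φ x / x) (Ioo 0 t) := by
  have hc := h.continuous hγ
  have hi := (integrableOn_sub_rpow (x := 0) (t := t) (p := γ - 1) (by linarith)).const_mul C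
  refine Integrable.mono' hi ?_ ?_
  · apply Measurable.aestronglyMeasurable
    fun_prop
  · refine (ae_restrict_iff' measurableSet_Ioo).2 (ae_of_all _ fun x hx => ?_)
    have hx0 : 0 < x := hx.1
    have h1 := h x 0
    rw [h0, sub_zero, sub_zero, abs_of_pos hx0] at h1
    rw [Real.norm_eq_abs, abs_div, abs_of_pos hx0, div_le_iff₀ hx0, sub_zero,
      Real.rpow_sub_one hx0.ne']
    field_simp
    exact h1

/-- Prepares the exchange of integrals in `integral_truncKernel`: for fixed `u` the integral in `x`
is explicit by `integral_beta_kernel`, and what remains is a multiple of `φ u / u`. -/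
lemma integrable_truncated_pair {C γ β t ε : ℝ} {φ : ℝ → ℝ} (h : HolderBound C γ φ) (hγ : 0 < γ)
    (h0 : φ 0 = 0) (hβ : 0 < β) (hε : 0 < ε) :
    Integrable (fun p : ℝ × ℝ => p.1 ^ (β - 1) * (Ioi ((1 + ε) * p.1)).indicator
      (fun u => φ u / (u - p.1) ^ (1 + β)) p.2)
      ((volume.restrict (Ioo 0 t)).prod (volume.restrict (Ioo 0 t))) ∧
    ∀ u ∈ Ioo 0 t, ∫ x in Ioo 0 t, x ^ (β - 1) * (Ioi ((1 + ε) * x)).indicator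
      (fun u => φ u / (u - x) ^ (1 + β)) u = (φ u / u) / (β * ε ^ β) := by
  have hc := h.continuous hγ
  -- Stated for an arbitrary `ρ` because it serves both for `φ` and, to get absolute integrability,
  -- for `|φ|`.
  have key : ∀ (ρ : ℝ → ℝ), ∀ u ∈ Ioo 0 t,
      IntegrableOn (fun x => x ^ (β - 1) * (Ioi ((1 + ε) * x)).indicator
        (fun u => ρ u / (u - x) ^ (1 + β)) u) (Ioo 0 t) ∧
      ∫ x in Ioo 0 t, x ^ (β - 1) * (Ioi ((1 + ε) * x)).indicator
        (fun u => ρ u / (u - x) ^ (1 + β)) u = (ρ u / u) / (β * ε ^ β) := by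
    intro ρ u hu
    have hu0 : 0 < u := hu.1
    have hv : 0 < u / (1 + ε) := by positivity
    have hvu : u / (1 + ε) < u := by
      rw [div_lt_iff₀ (by positivity)]; nlinarith
    have e1 : ∀ x, x ^ (β - 1) * (Ioi ((1 + ε) * x)).indicator
        (fun u => ρ u / (u - x) ^ (1 + β)) u = (Iio (u / (1 + ε))).indicator
        (fun x => ρ u * (x ^ (β - 1) / (u - x) ^ (1 + β))) x := by
      intro x
      by_cases hx : (1 + ε) * x < u
      · have hx' : x < u / (1 + ε) := by
          rw [lt_div_iff₀ (by positivity)]; linarith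
        rw [indicator_of_mem (by exact hx), indicator_of_mem (by exact hx')]
        ring
      · have hx' : ¬ x < u / (1 + ε) := by
          rw [lt_div_iff₀ (by positivity)]; linarith
        rw [indicator_of_notMem (by exact hx), indicator_of_notMem (by exact hx'), mul_zero]
    have e2 : Ioo 0 t ∩ Iio (u / (1 + ε)) = Ioo 0 (u / (1 + ε)) := by
      rw [Ioo_inter_Iio, min_eq_right (hvu.le.trans hu.2.le)]
    obtain ⟨h1, h2⟩ := integral_beta_kernel hβ hv hvu
    simp_rw [e1]
    constructor
    · rw [IntegrableOn, integrable_indicator_iff measurableSet_Iio, IntegrableOn,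
        Measure.restrict_restrict measurableSet_Iio, inter_comm, e2]
      exact h1.const_mul _
    · rw [setIntegral_indicator measurableSet_Iio, e2, integral_const_mul, h2]
      -- Since the truncation is proportional to `x`, this ratio does not depend on `u`.
      have : u / (1 + ε) / (u - u / (1 + ε)) = ε⁻¹ := by
        have : u - u / (1 + ε) = u * ε / (1 + ε) := by field_simp; ring
        rw [this]; field_simp
      rw [this, Real.inv_rpow hε.le]
      field_simp
  refine ⟨?_, fun u hu => (key φ u hu).2⟩
  have hmeas : Measurable (fun p : ℝ × ℝ => p.1 ^ (β - 1) * (Ioi ((1 + ε) * p.1)).indicator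
      (fun u => φ u / (u - p.1) ^ (1 + β)) p.2) := by
    have hS : MeasurableSet {p : ℝ × ℝ | (1 + ε) * p.1 < p.2} :=
      measurableSet_lt (by fun_prop) (by fun_prop)
    have : (fun p : ℝ × ℝ => (Ioi ((1 + ε) * p.1)).indicator
      (fun u => φ u / (u - p.1) ^ (1 + β)) p.2) = {p : ℝ × ℝ | (1 + ε) * p.1 < p.2}.indicator
        (fun p => φ p.2 / (p.2 - p.1) ^ (1 + β)) := by
      ext p
      simp only [indicator, mem_Ioi, mem_ofPred_eq]
    refine Measurable.mul (by fun_prop) ?_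
    rw [this]
    refine Measurable.indicator ?_ hS
    fun_prop
  rw [integrable_prod_iff' hmeas.aestronglyMeasurable]
  constructor
  · exact (ae_restrict_iff' measurableSet_Ioo).2 (ae_of_all _ fun u hu => (key φ u hu).1)
  · refine (((h.integrableOn_div hγ h0).norm.div_const (β * ε ^ β))).congr ?_
    refine (ae_restrict_iff' measurableSet_Ioo).2 (ae_of_all _ fun u hu => ?_)
    have := (key (fun u => |φ u|) u hu).2
    simp only [Real.norm_eq_abs, abs_div, abs_of_pos hu.1]
    rw [← this]
    refine setIntegral_congr_fun measurableSet_Ioo fun x hx => ?_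
    have hx0 : 0 < x := hx.1
    simp only [abs_mul, abs_of_pos (Real.rpow_pos_of_pos hx0 (β - 1))]
    congr 1
    by_cases hxu : u ∈ Ioi ((1 + ε) * x)
    · have : 0 < u - x := by
        have : (1 + ε) * x < u := hxu
        nlinarith
      simp only [indicator_of_mem hxu, abs_div, abs_of_pos (Real.rpow_pos_of_pos this _)]
    · simp only [indicator_of_notMem hxu, abs_zero]

/-- The two terms cancel exactly for every `ε`: the first contributes `φ x / x` over `ε ^ β`, and
after Fubini so does the second. A truncation at a fixed distance from `x` would not scale in this
way. -/
lemma integral_truncKernel {C γ β t ε : ℝ} {φ : ℝ → ℝ} (h : HolderBound C γ φ) (hγ : 0 < γ)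
    (h0 : φ 0 = 0) (hβ : 0 < β) (hε : 0 < ε) :
    IntegrableOn (fun x => x ^ (β - 1) * truncKernel β t ε φ x) (Ioo 0 t) ∧
    ∫ x in Ioo 0 t, x ^ (β - 1) * truncKernel β t ε φ x = 0 := by
  obtain ⟨hi, hv⟩ := integrable_truncated_pair (t := t) h hγ h0 hβ hε
  have e : ∀ x ∈ Ioo 0 t, x ^ (β - 1) * truncKernel β t ε φ x =
      (φ x / x) / ε ^ β - β * ∫ u in Ioo 0 t, x ^ (β - 1) * (Ioi ((1 + ε) * x)).indicator
        (fun u => φ u / (u - x) ^ (1 + β)) u := by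
    intro x hx
    have hx0 : 0 < x := hx.1
    rw [truncKernel, integral_const_mul, Real.mul_rpow hε.le hx0.le, Real.rpow_sub_one hx0.ne']
    field_simp
  have h1 := (h.integrableOn_div (t := t) hγ h0).div_const (ε ^ β)
  have h2 := hi.integral_prod_left.const_mul β
  refine ⟨(integrableOn_congr_fun e measurableSet_Ioo).2 (h1.sub h2), ?_⟩
  rw [setIntegral_congr_fun measurableSet_Ioo e, integral_sub h1 h2, integral_const_mul,
    integral_integral_swap hi, setIntegral_congr_fun measurableSet_Ioo hv, integral_div,
    integral_div]
  field_simp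
  ring

/-- Integrating `β (u - x)^(-1-β)` from `(1 + ε) x` to `t` gives `(ε x)^(-β) - (t - x)^(-β)`, which
converts one boundary term into the other. -/
lemma truncKernel_eq {C γ β t ε x : ℝ} {φ : ℝ → ℝ} (h : HolderBound C γ φ) (hγ : 0 < γ)
    (hβ : 0 < β) (hε : 0 < ε) (hx : 0 < x) (hxt : (1 + ε) * x ≤ t) :
    truncKernel β t ε φ x =
      φ x / (t - x) ^ β + β * ∫ u in ((1 + ε) * x)..t, (φ x - φ u) / (u - x) ^ (1 + β) := by
  have hc := h.continuous hγ
  have hxa : x < (1 + ε) * x := by nlinarith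
  have hpos : ∀ u ∈ uIcc ((1 + ε) * x) t, 0 < u - x := by
    intro u hu
    rw [uIcc_of_le hxt] at hu
    linarith [hu.1]
  have hi : ∀ ρ : ℝ → ℝ, Continuous ρ →
      IntervalIntegrable (fun u => ρ u / (u - x) ^ (1 + β)) volume ((1 + ε) * x) t := by
    intro ρ hρ
    refine ContinuousOn.intervalIntegrable (hρ.continuousOn.div ?_ ?_)
    · exact ContinuousOn.rpow_const (by fun_prop) fun u hu => Or.inl (hpos u hu).ne'
    · exact fun u hu => (Real.rpow_pos_of_pos (hpos u hu) _).ne'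
  have e1 : ∫ u in Ioo 0 t, (Ioi ((1 + ε) * x)).indicator
      (fun u => φ u / (u - x) ^ (1 + β)) u =
      ∫ u in ((1 + ε) * x)..t, φ u / (u - x) ^ (1 + β) := by
    rw [setIntegral_indicator measurableSet_Ioi, intervalIntegral.integral_of_le hxt,
      integral_Ioc_eq_integral_Ioo]
    congr 2
    rw [Ioo_inter_Ioi, max_eq_right (by positivity)]
  have e2 : ∫ u in ((1 + ε) * x)..t, (φ x - φ u) / (u - x) ^ (1 + β) =
      φ x * (((ε * x) ^ (-β) - (t - x) ^ (-β)) / β) -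
        ∫ u in ((1 + ε) * x)..t, φ u / (u - x) ^ (1 + β) := by
    rw [← show (1 + ε) * x - x = ε * x by ring, ← integral_shifted_rpow hβ hxa hxt,
      ← intervalIntegral.integral_const_mul, ← intervalIntegral.integral_sub]
    · refine intervalIntegral.integral_congr fun u _ => ?_
      ring
    · exact (hi _ continuous_const).const_mul _
    · exact hi _ hc
  rw [truncKernel, e1, e2, Real.rpow_neg (by positivity), Real.rpow_neg (by nlinarith)]
  field_simp
  ring

/-- The bound is uniform in `ε` and `x`, as dominated convergence requires. -/
lemma abs_truncKernel_le {C γ β t ε x : ℝ} {φ : ℝ → ℝ} (h : HolderBound C γ φ) (hγ : 0 < γ)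
    (ht : φ t = 0) (hβ : 0 < β) (hβγ : β < γ) (hε : 0 < ε) (hx : x ∈ Ioo 0 t) :
    |truncKernel β t ε φ x| ≤ C * t ^ (γ - β) * (1 + β / (γ - β)) := by
  have hC : 0 ≤ C := by simpa using (abs_nonneg _).trans (h 0 1)
  have hx0 := hx.1
  have hxt : 0 < t - x := sub_pos.2 hx.2
  have hγβ : 0 < γ - β := sub_pos.2 hβγ
  have hpow : (t - x) ^ (γ - β) ≤ t ^ (γ - β) :=
    Real.rpow_le_rpow hxt.le (by linarith) hγβ.le
  have hφ : |φ x| ≤ C * (t - x) ^ γ := by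
    have := h x t
    rwa [ht, sub_zero, abs_sub_comm, abs_of_pos hxt] at this
  have hφ' : |φ x| / (t - x) ^ β ≤ C * t ^ (γ - β) := by
    calc |φ x| / (t - x) ^ β ≤ C * (t - x) ^ γ / (t - x) ^ β := by gcongr
      _ = C * (t - x) ^ (γ - β) := by rw [Real.rpow_sub hxt, mul_div_assoc]
      _ ≤ _ := by gcongr
  rcases le_or_gt ((1 + ε) * x) t with hle | hgt
  · rw [truncKernel_eq h hγ hβ hε hx0 hle]
    have h2 := h.abs_integral_kernel_le hβγ (x := x) (by nlinarith) hle
    set J := ∫ u in ((1 + ε) * x)..t, (φ x - φ u) / (u - x) ^ (1 + β)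
    calc _ ≤ |φ x / (t - x) ^ β| + |β * J| := abs_add_le _ _
      _ = |φ x| / (t - x) ^ β + β * |J| := by
        rw [abs_div, abs_mul, abs_of_pos hβ, abs_of_pos (Real.rpow_pos_of_pos hxt _)]
      _ ≤ C * t ^ (γ - β) + β * (C * (t ^ (γ - β) / (γ - β))) := by
        gcongr
        refine h2.trans ?_
        gcongr
      _ = _ := by ring
  -- Here the truncated range is empty and `t - x < ε x`, so the boundary term alone is controlled
  -- by the Hölder bound at `t`.
  · have e1 : ∫ u in Ioo 0 t, (Ioi ((1 + ε) * x)).indicator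
        (fun u => φ u / (u - x) ^ (1 + β)) u = 0 := by
      rw [setIntegral_congr_fun (g := 0) measurableSet_Ioo]
      · simp
      · intro u hu
        exact indicator_of_notMem (by simpa using (hu.2.trans hgt).le) _
    rw [truncKernel, e1, mul_zero, sub_zero, abs_div,
      abs_of_pos (Real.rpow_pos_of_pos (by positivity : 0 < ε * x) _)]
    calc |φ x| / (ε * x) ^ β ≤ |φ x| / (t - x) ^ β := by
          gcongr
          linarith
      _ ≤ C * t ^ (γ - β) := hφ'
      _ ≤ _ := le_mul_of_one_le_right
        (mul_nonneg hC (Real.rpow_nonneg (hx0.trans hx.2).le _)) (by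
          have := (div_pos hβ hγβ).le
          linarith)

lemma tendsto_truncKernel {C γ β t x : ℝ} {φ : ℝ → ℝ} (h : HolderBound C γ φ) (hγ : 0 < γ)
    (hβ : 0 < β) (hβγ : β < γ) (hx : x ∈ Ioo 0 t) :
    Tendsto (fun n : ℕ => truncKernel β t (1 / ((n : ℝ) + 1)) φ x) atTop
      (𝓝 (rightKernel β t φ x)) := by
  have hx0 := hx.1
  have hlim : Tendsto (fun n : ℕ => (1 + 1 / ((n : ℝ) + 1)) * x) atTop (𝓝 x) := by
    have := (tendsto_one_div_add_atTop_nhds_zero_nat (𝕜 := ℝ)).const_add 1 |>.mul_const x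
    simpa using this
  have hev : ∀ᶠ n : ℕ in atTop, (1 + 1 / ((n : ℝ) + 1)) * x ≤ t :=
    (hlim.eventually_lt_const hx.2).mono fun _ h => h.le
  have hge : ∀ n : ℕ, x ≤ (1 + 1 / ((n : ℝ) + 1)) * x := fun n => by
    have : 0 < 1 / ((n : ℝ) + 1) := by positivity
    nlinarith
  have hcont := intervalIntegral.continuousOn_primitive_interval_left (a := x) (b := t)
    (f := fun u => (φ x - φ u) / (u - x) ^ (1 + β)) (μ := volume) (by
      rw [uIcc_of_le hx.2.le, integrableOn_Icc_iff_integrableOn_Ioo]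
      exact h.integrableOn_kernel hγ hβγ x t)
  have hw := hcont x left_mem_uIcc
  have hlim' : Tendsto (fun n : ℕ => (1 + 1 / ((n : ℝ) + 1)) * x) atTop (𝓝[uIcc x t] x) := by
    refine tendsto_nhdsWithin_iff.2 ⟨hlim, ?_⟩
    filter_upwards [hev] with n hn
    rw [uIcc_of_le hx.2.le]
    exact ⟨hge n, hn⟩
  refine (((hw.tendsto.comp hlim').const_mul β).const_add (φ x / (t - x) ^ β)).congr' ?_
  filter_upwards [hev] with n hn
  rw [truncKernel_eq h hγ hβ (by positivity) hx0 hn]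
  rfl

/-- The fractional integral of the fractional derivative vanishes at a zero of a Hölder function
which also vanishes at the right end point. -/
theorem integral_rightKernel_eq_zero {C γ β t : ℝ} {φ : ℝ → ℝ} (h : HolderBound C γ φ)
    (hγ : 0 < γ) (h0 : φ 0 = 0) (ht : φ t = 0) (hβ : 0 < β) (hβγ : β < γ) :
    ∫ x in Ioo 0 t, x ^ (β - 1) * rightKernel β t φ x = 0 := by
  have hlim : Tendsto (fun n : ℕ => ∫ x in Ioo 0 t,
      x ^ (β - 1) * truncKernel β t (1 / ((n : ℝ) + 1)) φ x) atTop
      (𝓝 (∫ x in Ioo 0 t, x ^ (β - 1) * rightKernel β t φ x)) := by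
    -- The uniform bound on the truncated kernels times `x ^ (β - 1)` is an integrable majorant as
    -- `ε = 1 / (n + 1)` tends to zero.
    have hb := (integrableOn_sub_rpow (x := 0) (t := t) (p := β - 1) (by linarith)).mul_const
      (C * t ^ (γ - β) * (1 + β / (γ - β)))
    refine tendsto_integral_of_dominated_convergence _
      (fun n => (integral_truncKernel h hγ h0 hβ (by positivity)).1.1) hb (fun n => ?_) ?_
    · refine (ae_restrict_iff' measurableSet_Ioo).2 (ae_of_all _ fun x hx => ?_)
      rw [Real.norm_eq_abs, abs_mul, abs_of_pos (Real.rpow_pos_of_pos hx.1 _), sub_zero]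
      have := hx.1
      gcongr
      exact abs_truncKernel_le h hγ ht hβ hβγ (by positivity) hx
    · refine (ae_restrict_iff' measurableSet_Ioo).2 (ae_of_all _ fun x hx => ?_)
      exact (tendsto_truncKernel h hγ hβ hβγ hx).const_mul _
  have hz : ∀ n : ℕ, ∫ x in Ioo 0 t,
      x ^ (β - 1) * truncKernel β t (1 / ((n : ℝ) + 1)) φ x = 0 := fun n =>
    (integral_truncKernel h hγ h0 hβ (by positivity)).2
  simp_rw [hz] at hlim
  exact tendsto_nhds_unique hlim tendsto_const_nhds

lemma abs_rightKernel_le {C γ β t x : ℝ} {φ : ℝ → ℝ} (h : HolderBound C γ φ)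
    (ht : φ t = 0) (hβ : 0 < β) (hβγ : β < γ) (hx : x ∈ Ioo 0 t) :
    |rightKernel β t φ x| ≤ C * t ^ (γ - β) * (1 + β / (γ - β)) := by
  have hγ := hβ.trans hβγ
  refine le_of_tendsto (tendsto_truncKernel h hγ hβ hβγ hx).abs (Eventually.of_forall fun n => ?_)
  exact abs_truncKernel_le h hγ ht hβ hβγ (by positivity) hx

lemma aestronglyMeasurable_rightKernel {β t : ℝ} {φ : ℝ → ℝ} (hφ : Measurable φ) (s : ℝ) :
    AEStronglyMeasurable (rightKernel β t φ) (volume.restrict (Ioo s t)) := by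
  have hS : MeasurableSet {p : ℝ × ℝ | p.1 < p.2 ∧ p.2 ≤ t} :=
    (measurableSet_lt measurable_fst measurable_snd).inter
      (measurableSet_le measurable_snd measurable_const)
  have hm : Measurable ({p : ℝ × ℝ | p.1 < p.2 ∧ p.2 ≤ t}.indicator
      fun p => (φ p.1 - φ p.2) / (p.2 - p.1) ^ (1 + β)) := by
    refine Measurable.indicator ?_ hS
    fun_prop
  have hm2 := hm.stronglyMeasurable.integral_prod_right' (ν := volume)
  have : AEStronglyMeasurable (fun x => φ x / (t - x) ^ β + β * ∫ u,
      {p : ℝ × ℝ | p.1 < p.2 ∧ p.2 ≤ t}.indicator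
      (fun p => (φ p.1 - φ p.2) / (p.2 - p.1) ^ (1 + β)) (x, u)) (volume.restrict (Ioo s t)) := by
    have : Measurable fun x => φ x / (t - x) ^ β := by fun_prop
    exact this.aestronglyMeasurable.add (hm2.aestronglyMeasurable.const_mul β)
  refine this.congr ((ae_restrict_iff' measurableSet_Ioo).2 (ae_of_all _ fun x hx => ?_))
  simp only [rightKernel]
  rw [intervalIntegral.integral_of_le hx.2.le, ← integral_indicator measurableSet_Ioc]
  rfl

lemma integrableOn_rightKernel {C γ β t : ℝ} {φ : ℝ → ℝ} (h : HolderBound C γ φ)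
    (ht : φ t = 0) (hβ : 0 < β) (hβγ : β < γ) :
    IntegrableOn (fun x => x ^ (β - 1) * rightKernel β t φ x) (Ioo 0 t) := by
  have hγ := hβ.trans hβγ
  have hi := (integrableOn_sub_rpow (x := 0) (t := t) (p := β - 1) (by linarith))
  simp only [sub_zero] at hi
  refine Integrable.mul_bdd (c := C * t ^ (γ - β) * (1 + β / (γ - β))) hi
    (aestronglyMeasurable_rightKernel (h.continuous hγ).measurable 0)
    ((ae_restrict_iff' measurableSet_Ioo).2 (ae_of_all _ fun x hx => ?_))
  exact abs_rightKernel_le h ht hβ hβγ hx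

lemma rightKernel_sub_const_mul {C C' γ β t x k : ℝ} {φ ρ : ℝ → ℝ} (h : HolderBound C γ φ)
    (h' : HolderBound C' γ ρ) (hγ : 0 < γ) (hβγ : β < γ) (hx : x ≤ t) :
    rightKernel β t (fun y => φ y - k * ρ y) x =
      rightKernel β t φ x - k * rightKernel β t ρ x := by
  have h1 : IntervalIntegrable (fun u => (φ x - φ u) / (u - x) ^ (1 + β)) volume x t :=
    (intervalIntegrable_iff_integrableOn_Ioo_of_le hx).2 (h.integrableOn_kernel hγ hβγ x t)
  have h2 : IntervalIntegrable (fun u => (ρ x - ρ u) / (u - x) ^ (1 + β)) volume x t :=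
    (intervalIntegrable_iff_integrableOn_Ioo_of_le hx).2 (h'.integrableOn_kernel hγ hβγ x t)
  have e : ∫ u in x..t, (φ x - k * ρ x - (φ u - k * ρ u)) / (u - x) ^ (1 + β) =
      (∫ u in x..t, (φ x - φ u) / (u - x) ^ (1 + β)) -
        k * ∫ u in x..t, (ρ x - ρ u) / (u - x) ^ (1 + β) := by
    rw [← intervalIntegral.integral_const_mul, ← intervalIntegral.integral_sub h1 (h2.const_mul k)]
    refine intervalIntegral.integral_congr fun u _ => ?_
    ring
  simp only [rightKernel]
  rw [e]
  ring

lemma integral_rpow_mul_sub_rpow {a b t : ℝ} (ha : 0 < a) (hb : 0 < b) (ht : 0 < t) :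
    ∫ x in Ioo 0 t, x ^ (a - 1) * (t - x) ^ (b - 1) = t ^ (a + b - 1) * beta a b := by
  have h := Complex.betaIntegral_scaled a b ht
  have h2 : Complex.betaIntegral a b = (beta a b : ℂ) := by
    rw [Complex.betaIntegral_eq_Gamma_mul_div _ _ (by simpa) (by simpa), beta,
      ← Complex.ofReal_add]
    simp_rw [Complex.Gamma_ofReal]
    push_cast
    rfl
  rw [h2] at h
  rw [← integral_Ioc_eq_integral_Ioo, ← intervalIntegral.integral_of_le ht.le]
  apply Complex.ofReal_injective
  rw [← intervalIntegral.integral_ofReal]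
  push_cast
  rw [Complex.ofReal_cpow ht.le]
  push_cast
  rw [← h]
  refine intervalIntegral.integral_congr fun x hx => ?_
  rw [uIcc_of_le ht.le] at hx
  rw [Complex.ofReal_cpow hx.1, Complex.ofReal_cpow (sub_nonneg.2 hx.2)]
  push_cast
  rfl

/-- The function `t - x`, made constant outside `[0, t]`. -/
def ramp (t x : ℝ) : ℝ := t - max 0 (min x t)

lemma ramp_of_mem {t x : ℝ} (hx : x ∈ Icc 0 t) : ramp t x = t - x := by
  rw [ramp, min_eq_left hx.2, max_eq_right hx.1]

/-- The ramp is 1-Lipschitz with oscillation at most `t`; the Hölder bound interpolates between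
these two facts. -/
lemma holderBound_ramp {t γ : ℝ} (ht : 0 < t) (hγ0 : 0 < γ) (hγ : γ ≤ 1) :
    HolderBound (t ^ (1 - γ)) γ (ramp t) := by
  intro x y
  have h1 : |ramp t x - ramp t y| ≤ |x - y| := by
    have h2 : ramp t x - ramp t y = max 0 (min y t) - max 0 (min x t) := by simp only [ramp]; ring
    rw [h2, abs_sub_comm x y]
    exact (abs_max_sub_max_le_max 0 _ 0 _).trans (max_le (by simp)
      ((abs_min_sub_min_le_max _ t _ t).trans (max_le le_rfl (by simp))))
  have h2 : |ramp t x - ramp t y| ≤ t := by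
    have b : ∀ z, 0 ≤ ramp t z ∧ ramp t z ≤ t := fun z =>
      ⟨sub_nonneg.2 (max_le ht.le (min_le_right _ _)), sub_le_self _ (le_max_left _ _)⟩
    rw [abs_le]
    constructor <;> linarith [b x, b y]
  rcases (abs_nonneg (ramp t x - ramp t y)).eq_or_lt with h0 | h0
  · rw [← h0]; positivity
  calc |ramp t x - ramp t y|
      = |ramp t x - ramp t y| ^ (1 - γ) * |ramp t x - ramp t y| ^ γ := by
        rw [← Real.rpow_add h0]; simp
    _ ≤ t ^ (1 - γ) * |x - y| ^ γ := by
        gcongr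

lemma rightKernel_ramp {β t x : ℝ} (hβ1 : β < 1) (hx : x ∈ Ioo 0 t) :
    rightKernel β t (ramp t) x = (t - x) ^ (1 - β) / (1 - β) := by
  have hxt : 0 < t - x := sub_pos.2 hx.2
  have e : ∫ u in x..t, (ramp t x - ramp t u) / (u - x) ^ (1 + β) =
      (t - x) ^ (1 - β) / (1 - β) := by
    rw [intervalIntegral.integral_of_le hx.2.le, integral_Ioc_eq_integral_Ioo,
      show 1 - β = -β + 1 by ring, ← integral_sub_rpow (by linarith) hx.2.le]
    refine setIntegral_congr_fun measurableSet_Ioo fun u hu => ?_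
    have hu0 : 0 < u - x := sub_pos.2 hu.1
    rw [ramp_of_mem ⟨hx.1.le, hx.2.le⟩, ramp_of_mem ⟨(hx.1.trans hu.1).le, hu.2.le⟩,
      show t - x - (t - u) = u - x by ring, Real.rpow_add hu0, Real.rpow_one,
      Real.rpow_neg hu0.le]
    field_simp
  rw [rightKernel, e, ramp_of_mem ⟨hx.1.le, hx.2.le⟩, Real.rpow_sub hxt, Real.rpow_one]
  have : 1 - β ≠ 0 := by linarith
  field_simp
  ring

/-- The case of a linear function, which fixes the constant in the inversion formula through the
Beta integral. -/
lemma integral_rightKernel_ramp {β t : ℝ} (hβ : 0 < β) (hβ1 : β < 1) (ht : 0 < t) :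
    ∫ x in Ioo 0 t, x ^ (β - 1) * rightKernel β t (ramp t) x =
      Real.Gamma β * Real.Gamma (1 - β) * t := by
  have e : ∀ x ∈ Ioo 0 t, x ^ (β - 1) * rightKernel β t (ramp t) x =
      (1 - β)⁻¹ * (x ^ (β - 1) * (t - x) ^ (2 - β - 1)) := by
    intro x hx
    rw [rightKernel_ramp hβ1 hx, show 2 - β - 1 = 1 - β by ring]
    ring
  rw [setIntegral_congr_fun measurableSet_Ioo e, integral_const_mul,
    integral_rpow_mul_sub_rpow hβ (by linarith) ht, beta, show β + (2 - β) = 2 by ring,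
    show (2 : ℝ) - β = (1 - β) + 1 by ring, Real.Gamma_add_one (by linarith), Real.Gamma_two]
  have : 1 - β ≠ 0 := by linarith
  norm_num
  field_simp

/-- Inversion of the right-sided fractional derivative of a Hölder function, at zero. -/
theorem integral_rightKernel_zero {C γ β t : ℝ} {g : ℝ → ℝ} (h : HolderBound C γ g)
    (hγ : γ ≤ 1) (hβ : 0 < β) (hβγ : β < γ) (ht : 0 < t) :
    ∫ x in Ioo 0 t, x ^ (β - 1) * rightKernel β t (recenter t g) x =
      Real.Gamma β * Real.Gamma (1 - β) * (g 0 - g t) := by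
  have hγ0 := hβ.trans hβγ
  have h1 : HolderBound C γ (recenter t g) := fun x y => by
    simpa [recenter] using h x y
  have h2 := holderBound_ramp ht hγ0 hγ
  -- Subtracting this multiple of the ramp makes the function vanish at both ends, so that
  -- `integral_rightKernel_eq_zero` applies.
  set k := (g 0 - g t) / t with hk
  have h3 : HolderBound (C + |k| * t ^ (1 - γ)) γ (fun y => recenter t g y - k * ramp t y) := by
    intro x y
    calc |recenter t g x - k * ramp t x - (recenter t g y - k * ramp t y)|
        = |(recenter t g x - recenter t g y) - k * (ramp t x - ramp t y)| := by ring_nf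
      _ ≤ |recenter t g x - recenter t g y| + |k * (ramp t x - ramp t y)| := abs_sub _ _
      _ ≤ C * |x - y| ^ γ + |k| * (t ^ (1 - γ) * |x - y| ^ γ) := by
          rw [abs_mul]
          gcongr
          · exact h1 x y
          · exact h2 x y
      _ = _ := by ring
  have r0 : ramp t 0 = t := by rw [ramp_of_mem ⟨le_rfl, ht.le⟩, sub_zero]
  have rt : ramp t t = 0 := by rw [ramp_of_mem ⟨ht.le, le_rfl⟩, sub_self]
  have hz := integral_rightKernel_eq_zero (β := β) (t := t) h3 hγ0
    (by simp only [recenter, r0, hk]; field_simp; ring) (by simp [recenter, rt]) hβ hβγ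
  have e : ∀ x ∈ Ioo 0 t, x ^ (β - 1) * rightKernel β t
      (fun y => recenter t g y - k * ramp t y) x =
      x ^ (β - 1) * rightKernel β t (recenter t g) x -
        k * (x ^ (β - 1) * rightKernel β t (ramp t) x) := by
    intro x hx
    rw [rightKernel_sub_const_mul h1 h2 hγ0 hβγ hx.2.le]
    ring
  rw [setIntegral_congr_fun measurableSet_Ioo e, integral_sub
    (integrableOn_rightKernel h1 (by simp [recenter]) hβ hβγ)
    ((integrableOn_rightKernel h2 rt hβ hβγ).const_mul k), integral_const_mul,
    integral_rightKernel_ramp hβ (hβγ.trans_le hγ) ht, hk] at hz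
  field_simp at hz
  linarith

/-- Inversion of the right-sided fractional derivative of a Hölder function. -/
theorem integral_rightKernel {C γ β c t : ℝ} {g : ℝ → ℝ} (h : HolderBound C γ g)
    (hγ : γ ≤ 1) (hβ : 0 < β) (hβγ : β < γ) (ht : c < t) :
    ∫ x in Ioo c t, (x - c) ^ (β - 1) * rightKernel β t (recenter t g) x =
      Real.Gamma β * Real.Gamma (1 - β) * (g c - g t) := by
  have h1 : HolderBound C γ (fun y => g (y + c)) := fun x y => by
    simpa using h (x + c) (y + c)
  have h2 := integral_rightKernel_zero h1 hγ hβ hβγ (sub_pos.2 ht)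
  simp only [zero_add, sub_add_cancel] at h2
  rw [← h2, ← integral_Ioc_eq_integral_Ioo, ← intervalIntegral.integral_of_le ht.le,
    ← integral_Ioc_eq_integral_Ioo, ← intervalIntegral.integral_of_le (sub_pos.2 ht).le]
  have h3 := intervalIntegral.integral_comp_sub_right (a := c) (b := t) (fun x => x ^ (β - 1) *
    rightKernel β (t - c) (recenter (t - c) fun y => g (y + c)) x) c
  rw [sub_self] at h3
  rw [← h3]
  refine intervalIntegral.integral_congr fun x _ => ?_
  simp only [rightKernel, recenter, sub_add_cancel, sub_sub_sub_cancel_right]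
  congr 3
  have h4 := intervalIntegral.integral_comp_sub_right (a := x) (b := t)
    (fun u => (g x - g (u + c)) / (u - (x - c)) ^ (1 + β)) c
  rw [← h4]
  refine intervalIntegral.integral_congr fun u _ => ?_
  simp

/-! ### Locality and linearity of the generalized Lebesgue–Stieltjes integral -/

lemma leftDeriv_congr {α a b : ℝ} {f f' : ℝ → ℝ} (h : EqOn f f' (Ioo a b)) :
    leftDeriv α a b f = leftDeriv α a b f' := by
  refine indicator_congr fun x hx => ?_
  rw [h hx, intervalIntegral.integral_of_le hx.1.le, intervalIntegral.integral_of_le hx.1.le,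
    integral_Ioc_eq_integral_Ioo, integral_Ioc_eq_integral_Ioo]
  congr 3
  refine setIntegral_congr_fun measurableSet_Ioo fun u hu => ?_
  simp only [h ⟨hu.1, hu.2.trans hx.2⟩]

lemma rightDeriv_congr {α a b : ℝ} {g g' : ℝ → ℝ} (h : EqOn g g' (Ioc a b)) :
    rightDeriv α a b g = rightDeriv α a b g' := by
  refine indicator_congr fun x hx => ?_
  rw [h ⟨hx.1, hx.2.le⟩, intervalIntegral.integral_of_le hx.2.le,
    intervalIntegral.integral_of_le hx.2.le]
  congr 3
  refine setIntegral_congr_fun measurableSet_Ioc fun u hu => ?_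
  simp only [h ⟨hx.1.trans hu.1, hu.2⟩]

lemma recenter_congr {a b : ℝ} {g g' : ℝ → ℝ} (hab : a < b) (h : EqOn g g' (Ioc a b)) :
    EqOn (recenter b g) (recenter b g') (Ioc a b) := fun x hx => by
  simp only [recenter, h hx, h ⟨hab, le_rfl⟩]

lemma glsIntegral_congr {α a b : ℝ} {f f' g g' : ℝ → ℝ} (hf : EqOn f f' (Ioo a b))
    (hg : EqOn g g' (Ioc a b)) (hab : a ≤ b) :
    glsIntegral α a b f g = glsIntegral α a b f' g' := by
  rcases hab.eq_or_lt with rfl | hab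
  · simp [glsIntegral]
  · rw [glsIntegral, leftDeriv_congr hf, rightDeriv_congr (recenter_congr hab hg), glsIntegral]

lemma GLSIntegrable.congr {α a b : ℝ} {f f' g g' : ℝ → ℝ} (hf : EqOn f f' (Ioo a b))
    (hg : EqOn g g' (Ioc a b)) (h : GLSIntegrable α a b f g) : GLSIntegrable α a b f' g' := by
  rcases le_or_gt b a with hab | hab
  · have : Ioo a b = ∅ := Ioo_eq_empty_of_le hab
    constructor <;> simp [this]
  have hr := recenter_congr hab hg
  refine ⟨?_, ?_, leftDeriv_congr hf ▸ h.left_memLp, rightDeriv_congr hr ▸ h.right_memLp⟩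
  · filter_upwards [h.left_converges, ae_restrict_mem measurableSet_Ioo] with x hx hxm
    refine hx.congr_fun (fun u hu => ?_) measurableSet_Ioo
    simp only [hf hxm, hf ⟨hu.1, hu.2.trans hxm.2⟩]
  · filter_upwards [h.right_converges, ae_restrict_mem measurableSet_Ioo] with x hx hxm
    refine hx.congr_fun (fun u hu => ?_) measurableSet_Ioo
    simp only [hr ⟨hxm.1, hxm.2.le⟩, hr ⟨hxm.1.trans hu.1, hu.2.le⟩]

lemma fracNorm_congr {α a b : ℝ} {f f' : ℝ → ℝ} (hf : EqOn f f' (Ioo a b)) :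
    fracNorm α a b f = fracNorm α a b f' := by
  refine setLIntegral_congr_fun measurableSet_Ioo fun s hs => ?_
  rw [hf hs]
  congr 1
  refine setLIntegral_congr_fun measurableSet_Ioo fun z hz => ?_
  rw [hf ⟨hz.1, hz.2.trans hs.2⟩]

/-- `f` is a measurable function of finite norm on `[0, t]` whose integral with respect to `g` is
well defined and has the value `v`. -/
structure HasGLS (α t : ℝ) (f g : ℝ → ℝ) (v : ℝ) : Prop where
  measurable : Measurable f
  fracNorm_lt : fracNorm α 0 t f < ∞
  integrable : GLSIntegrable α 0 t f g
  integral_eq : glsIntegral α 0 t f g = v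

lemma measurable_inner_fracNorm {α a : ℝ} {f : ℝ → ℝ} (hf : Measurable f) :
    Measurable fun s => ∫⁻ z in Ioo a s, ENNReal.ofReal (|f s - f z| / (s - z) ^ (1 + α)) := by
  have hS : MeasurableSet {p : ℝ × ℝ | a < p.2 ∧ p.2 < p.1} :=
    (measurableSet_lt measurable_const measurable_snd).inter
      (measurableSet_lt measurable_snd measurable_fst)
  have hm : Measurable ({p : ℝ × ℝ | a < p.2 ∧ p.2 < p.1}.indicator
      fun p => ENNReal.ofReal (|f p.1 - f p.2| / (p.1 - p.2) ^ (1 + α))) := by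
    refine Measurable.indicator ?_ hS
    fun_prop
  convert hm.lintegral_prod_right' (ν := volume) using 2 with s
  rw [← lintegral_indicator measurableSet_Ioo]
  rfl

lemma fracNorm_add_const_mul_le {α a b k : ℝ} {f f' : ℝ → ℝ} (hf : Measurable f)
    (hf' : Measurable f') : fracNorm α a b (fun x => f x + k * f' x) ≤
      fracNorm α a b f + ENNReal.ofReal |k| * fracNorm α a b f' := by
  have key : ∀ x y d : ℝ, 0 ≤ d → ENNReal.ofReal (|x + k * y| / d) ≤
      ENNReal.ofReal (|x| / d) + ENNReal.ofReal |k| * ENNReal.ofReal (|y| / d) := by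
    intro x y d hd
    rw [← ENNReal.ofReal_mul (abs_nonneg k), ← ENNReal.ofReal_add (by positivity) (by positivity)]
    refine ENNReal.ofReal_le_ofReal ?_
    calc |x + k * y| / d ≤ (|x| + |k * y|) / d := by gcongr; exact abs_add_le _ _
      _ = _ := by rw [abs_mul]; ring
  have hi := measurable_inner_fracNorm (α := α) (a := a) hf
  have hi' := measurable_inner_fracNorm (α := α) (a := a) hf'
  have m1 : ∀ φ : ℝ → ℝ, Measurable φ →
      Measurable fun s => ENNReal.ofReal (|φ s| / (s - a) ^ α) := fun φ hφ => by fun_prop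
  have m2 : ∀ φ : ℝ → ℝ, Measurable φ → ∀ s,
      Measurable fun z => ENNReal.ofReal (|φ s - φ z| / (s - z) ^ (1 + α)) :=
    fun φ hφ s => by fun_prop
  simp only [fracNorm]
  rw [← lintegral_const_mul _ ((m1 f' hf').fun_add hi'), ← lintegral_add_left ((m1 f hf).fun_add hi)]
  refine setLIntegral_mono' measurableSet_Ioo fun s hs => ?_
  have hin : ∫⁻ z in Ioo a s, ENNReal.ofReal (|f s + k * f' s - (f z + k * f' z)| /
      (s - z) ^ (1 + α)) ≤
      (∫⁻ z in Ioo a s, ENNReal.ofReal (|f s - f z| / (s - z) ^ (1 + α))) +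
      ENNReal.ofReal |k| * ∫⁻ z in Ioo a s, ENNReal.ofReal (|f' s - f' z| / (s - z) ^ (1 + α)) := by
    rw [← lintegral_const_mul _ (m2 f' hf' s), ← lintegral_add_left (m2 f hf s)]
    refine setLIntegral_mono' measurableSet_Ioo fun z hz => ?_
    rw [show f s + k * f' s - (f z + k * f' z) = (f s - f z) + k * (f' s - f' z) by ring]
    exact key _ _ _ (Real.rpow_nonneg (sub_nonneg.2 hz.2.le) _)
  calc _ ≤ (ENNReal.ofReal (|f s| / (s - a) ^ α) + ENNReal.ofReal |k| *
        ENNReal.ofReal (|f' s| / (s - a) ^ α)) + _ :=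
        add_le_add (key _ _ _ (Real.rpow_nonneg (sub_nonneg.2 hs.1.le) _)) hin
    _ = _ := by ring

/-- The left derivative is additive only at points where both inner integrals converge, hence almost
everywhere; the products with the right derivative are integrable by the `L₁`–`L_∞` pairing. -/
lemma HasGLS.add_const_mul {α t v v' k : ℝ} {f f' g : ℝ → ℝ} (ht : 0 ≤ t)
    (h : HasGLS α t f g v) (h' : HasGLS α t f' g v') :
    HasGLS α t (fun x => f x + k * f' x) g (v + k * v') := by
  have hd : leftDeriv α 0 t (fun x => f x + k * f' x) =ᵐ[volume.restrict (Ioo 0 t)]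
      fun x => leftDeriv α 0 t f x + k * leftDeriv α 0 t f' x := by
    filter_upwards [h.integrable.left_converges, h'.integrable.left_converges,
      ae_restrict_mem measurableSet_Ioo] with x h1 h2 hx
    have h1' := (intervalIntegrable_iff_integrableOn_Ioo_of_le hx.1.le).2 h1
    have h2' := (intervalIntegrable_iff_integrableOn_Ioo_of_le hx.1.le).2 h2
    have e : ∫ u in 0..x, (f x + k * f' x - (f u + k * f' u)) / (x - u) ^ (1 + α) =
        (∫ u in 0..x, (f x - f u) / (x - u) ^ (1 + α)) +
          k * ∫ u in 0..x, (f' x - f' u) / (x - u) ^ (1 + α) := by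
      rw [← intervalIntegral.integral_const_mul,
        ← intervalIntegral.integral_add h1' (h2'.const_mul k)]
      refine intervalIntegral.integral_congr fun u _ => ?_
      ring
    simp only [leftDeriv, indicator_of_mem hx]
    rw [e]
    ring
  refine ⟨h.measurable.add (h'.measurable.const_mul k), ?_, ⟨?_, h.integrable.right_converges,
    ?_, h.integrable.right_memLp⟩, ?_⟩
  · refine (fracNorm_add_const_mul_le h.measurable h'.measurable).trans_lt ?_
    exact ENNReal.add_lt_top.2 ⟨h.fracNorm_lt,
      ENNReal.mul_lt_top ENNReal.ofReal_lt_top h'.fracNorm_lt⟩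
  · filter_upwards [h.integrable.left_converges, h'.integrable.left_converges] with x h1 h2
    have := Integrable.add h1 (Integrable.const_mul h2 k)
    refine this.congr (ae_of_all _ fun u => ?_)
    simp only [Pi.add_apply]
    ring
  · exact (memLp_congr_ae hd).2 (h.integrable.left_memLp.add (h'.integrable.left_memLp.const_mul k))
  · have i1 : Integrable (fun x => leftDeriv α 0 t f x *
        rightDeriv (1 - α) 0 t (recenter t g) x) (volume.restrict (Ioo 0 t)) :=
      h.integrable.left_memLp.integrable_mul h.integrable.right_memLp
    have i2 : Integrable (fun x => leftDeriv α 0 t f' x *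
        rightDeriv (1 - α) 0 t (recenter t g) x) (volume.restrict (Ioo 0 t)) :=
      h'.integrable.left_memLp.integrable_mul h.integrable.right_memLp
    have e1 := h.integral_eq
    have e2 := h'.integral_eq
    simp only [glsIntegral, intervalIntegral.integral_of_le ht, integral_Ioc_eq_integral_Ioo]
      at e1 e2 ⊢
    rw [← e1, ← e2]
    have : ∫ x in Ioo 0 t, leftDeriv α 0 t (fun x => f x + k * f' x) x *
        rightDeriv (1 - α) 0 t (recenter t g) x =
        ∫ x in Ioo 0 t, (leftDeriv α 0 t f x * rightDeriv (1 - α) 0 t (recenter t g) x +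
          k * (leftDeriv α 0 t f' x * rightDeriv (1 - α) 0 t (recenter t g) x)) := by
      refine integral_congr_ae ?_
      filter_upwards [hd] with x hx
      rw [hx]
      ring
    rw [this, integral_add i1 (i2.const_mul k), integral_const_mul]
    ring

/-! ### Integrals of step functions -/

/-- The indicator function of `[c, ∞)`. -/
def heaviside (c : ℝ) : ℝ → ℝ := (Ici c).indicator 1

lemma heaviside_of_le {c x : ℝ} (h : c ≤ x) : heaviside c x = 1 := indicator_of_mem (by exact h) _

lemma heaviside_of_lt {c x : ℝ} (h : x < c) : heaviside c x = 0 :=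
  indicator_of_notMem (by simpa using h) _

lemma heaviside_kernel {α c x : ℝ} (hα : 0 < α) (hc : 0 ≤ c) (hx : c < x) :
    IntegrableOn (fun u => (heaviside c x - heaviside c u) / (x - u) ^ (1 + α)) (Ioo 0 x) ∧
    ∫ u in Ioo 0 x, (heaviside c x - heaviside c u) / (x - u) ^ (1 + α) =
      ((x - c) ^ (-α) - x ^ (-α)) / α := by
  have e : (fun u => (heaviside c x - heaviside c u) / (x - u) ^ (1 + α)) =
      (Iio c).indicator fun u => 1 / (x - u) ^ (1 + α) := by
    ext u
    rcases lt_or_ge u c with hu | hu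
    · rw [heaviside_of_lt hu, heaviside_of_le hx.le, indicator_of_mem (by exact hu), sub_zero]
    · rw [heaviside_of_le hu, heaviside_of_le hx.le, indicator_of_notMem (by simpa using hu),
        sub_self, zero_div]
  have e2 : Ioo 0 x ∩ Iio c = Ioo 0 c := by
    rw [Ioo_inter_Iio, min_eq_right hx.le]
  constructor
  · rw [e, IntegrableOn, integrable_indicator_iff measurableSet_Iio, IntegrableOn,
      Measure.restrict_restrict measurableSet_Iio, inter_comm, e2]
    refine (ContinuousOn.integrableOn_Icc ?_).mono_set Ioo_subset_Icc_self
    refine continuousOn_const.div ?_ ?_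
    · exact ContinuousOn.rpow_const (by fun_prop) fun u hu => Or.inl (by linarith [hu.2])
    · exact fun u hu => (Real.rpow_pos_of_pos (by linarith [hu.2]) _).ne'
  · rw [e, setIntegral_indicator measurableSet_Iio, e2, ← integral_Ioc_eq_integral_Ioo,
      ← intervalIntegral.integral_of_le hc,
      intervalIntegral.integral_comp_sub_left (fun u => 1 / u ^ (1 + α)) x, sub_zero]
    have := integral_shifted_rpow (x := 0) (a := x - c) (t := x) hα (by linarith) (by linarith)
    simpa using this

/-- For `x > c` the term `x ^ (-α)` cancels against the boundary value of the inner integral. The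
point `x = c`, where that integral diverges, is negligible. -/
lemma leftDeriv_heaviside {α c t : ℝ} (hα : 0 < α) (hc : 0 ≤ c) :
    leftDeriv α 0 t (heaviside c) =ᵐ[volume.restrict (Ioo 0 t)]
      (Ioi c).indicator fun x => (1 / Real.Gamma (1 - α)) * (x - c) ^ (-α) := by
  have hne : ∀ᵐ x ∂volume.restrict (Ioo 0 t), x ≠ c :=
    ae_restrict_of_ae (Measure.ae_ne volume c)
  filter_upwards [ae_restrict_mem measurableSet_Ioo, hne] with x hx hxc
  have hx0 := hx.1
  rw [leftDeriv, indicator_of_mem hx, intervalIntegral.integral_of_le hx0.le,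
    integral_Ioc_eq_integral_Ioo]
  rcases hxc.lt_or_gt with h | h
  · rw [indicator_of_notMem (by simpa using h.le), heaviside_of_lt h,
      setIntegral_congr_fun (g := 0) measurableSet_Ioo]
    · simp
    · intro u hu
      simp [heaviside_of_lt (hu.2.trans h)]
  · rw [indicator_of_mem (by exact h), (heaviside_kernel hα hc h).2, heaviside_of_le h.le,
      sub_zero, Real.rpow_neg hx0.le]
    field_simp
    ring

lemma fracNorm_heaviside_lt_top {α c t : ℝ} (hα : 0 < α) (hα1 : α < 1) (hc : 0 ≤ c) :
    fracNorm α 0 t (heaviside c) < ∞ := by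
  have i1 := integrableOn_sub_rpow (x := 0) (t := t) (p := -α) (by linarith)
  have i2 : IntegrableOn ((Ioi c).indicator fun x => (x - c) ^ (-α) / α) (Ioo 0 t) := by
    rw [IntegrableOn, integrable_indicator_iff measurableSet_Ioi, IntegrableOn,
      Measure.restrict_restrict measurableSet_Ioi, inter_comm, Ioo_inter_Ioi]
    refine IntegrableOn.mono_set ?_ (Ioo_subset_Ioo_left (le_max_right 0 c))
    exact (integrableOn_sub_rpow (by linarith)).div_const α
  refine lt_of_le_of_lt ?_ (Integrable.lintegral_lt_top (Integrable.add i1 i2))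
  have hne : ∀ᵐ x ∂volume.restrict (Ioo 0 t), x ≠ c :=
    ae_restrict_of_ae (Measure.ae_ne volume c)
  refine lintegral_mono_ae ?_
  filter_upwards [ae_restrict_mem measurableSet_Ioo, hne] with s hs hsc
  have hs0 := hs.1
  simp only [Pi.add_apply]
  rcases hsc.lt_or_gt with h | h
  · rw [indicator_of_notMem (by simpa using h.le), heaviside_of_lt h,
      setLIntegral_congr_fun (g := 0) measurableSet_Ioo]
    · simp
    · intro u hu
      simp [heaviside_of_lt (hu.2.trans h)]
  · have hsc' : 0 < s - c := sub_pos.2 h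
    rw [indicator_of_mem (by exact h), ENNReal.ofReal_add (by positivity) (by positivity)]
    refine add_le_add ?_ ?_
    · rw [heaviside_of_le h.le, sub_zero, Real.rpow_neg hs0.le]
      simp
    · obtain ⟨k1, k2⟩ := heaviside_kernel hα hc h
      have e : ∀ z ∈ Ioo 0 s, ENNReal.ofReal (|heaviside c s - heaviside c z| /
          (s - z) ^ (1 + α)) = ENNReal.ofReal ((heaviside c s - heaviside c z) /
          (s - z) ^ (1 + α)) := by
        intro z hz
        rw [abs_of_nonneg]
        rw [heaviside_of_le h.le]
        rcases lt_or_ge z c with hu | hu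
        · rw [heaviside_of_lt hu]; norm_num
        · rw [heaviside_of_le hu]; norm_num
      rw [setLIntegral_congr_fun measurableSet_Ioo e, ← ofReal_integral_eq_lintegral_ofReal k1, k2]
      · refine ENNReal.ofReal_le_ofReal ?_
        gcongr
        have : 0 < s ^ (-α) := by positivity
        linarith
      · refine (ae_restrict_iff' measurableSet_Ioo).2 (ae_of_all _ fun z hz => ?_)
        have : 0 < s - z := sub_pos.2 hz.2
        refine div_nonneg ?_ (Real.rpow_nonneg this.le _)
        rw [heaviside_of_le h.le]
        rcases lt_or_ge z c with hu | hu
        · rw [heaviside_of_lt hu]; norm_num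
        · rw [heaviside_of_le hu]; norm_num

lemma rightDeriv_eq {α t x : ℝ} {φ : ℝ → ℝ} (hx : x ∈ Ioo 0 t) :
    rightDeriv (1 - α) 0 t φ x = (1 / Real.Gamma α) * rightKernel (1 - α) t φ x := by
  rw [rightDeriv, indicator_of_mem hx, rightKernel, sub_sub_cancel]

/-- Pairing `(x - c) ^ (-α)` with the right derivative of order `1 - α` is the inversion formula
with `β = 1 - α`; the Gamma factors cancel. The minimum covers `c ≥ t`, where the integral is zero.
-/
theorem hasGLS_heaviside {C γ α c t : ℝ} {g : ℝ → ℝ} (h : HolderBound C γ g) (hγ : γ ≤ 1)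
    (hα : 0 < α) (hα1 : α < 1) (hαγ : 1 - α < γ) (hc : 0 ≤ c) (ht : 0 ≤ t) :
    HasGLS α t (heaviside c) g (g t - g (min c t)) := by
  have hγ0 : 0 < γ := by linarith
  have hr : HolderBound C γ (recenter t g) := fun x y => by
    simpa [recenter] using h x y
  have hd := leftDeriv_heaviside (t := t) hα hc
  refine ⟨measurable_one.indicator measurableSet_Ici, fracNorm_heaviside_lt_top hα hα1 hc,
    ⟨?_, ?_, ?_, ?_⟩, ?_⟩
  · have hne : ∀ᵐ x ∂volume.restrict (Ioo 0 t), x ≠ c :=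
      ae_restrict_of_ae (Measure.ae_ne volume c)
    filter_upwards [ae_restrict_mem measurableSet_Ioo, hne] with x hx hxc
    rcases hxc.lt_or_gt with h | h
    · refine integrableOn_zero.congr_fun (fun u hu => ?_) measurableSet_Ioo
      simp [heaviside_of_lt (hu.2.trans h), heaviside_of_lt h]
    · exact (heaviside_kernel hα hc h).1
  · exact ae_of_all _ fun x => hr.integrableOn_kernel hγ0 hαγ x t
  · refine (memLp_congr_ae hd).2 (memLp_one_iff_integrable.2 ?_)
    rw [integrable_indicator_iff measurableSet_Ioi, IntegrableOn,
      Measure.restrict_restrict measurableSet_Ioi, inter_comm, Ioo_inter_Ioi]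
    refine IntegrableOn.mono_set ?_ (Ioo_subset_Ioo_left (le_max_right 0 c))
    exact (integrableOn_sub_rpow (by linarith)).const_mul _
  · have e : rightDeriv (1 - α) 0 t (recenter t g) =ᵐ[volume.restrict (Ioo 0 t)]
        fun x => (1 / Real.Gamma α) * rightKernel (1 - α) t (recenter t g) x := by
      filter_upwards [ae_restrict_mem measurableSet_Ioo] with x hx using rightDeriv_eq hx
    refine (memLp_congr_ae e).2 (MemLp.const_mul ?_ _)
    refine memLp_top_of_bound
      (aestronglyMeasurable_rightKernel (hr.continuous hγ0).measurable 0)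
      (C * t ^ (γ - (1 - α)) * (1 + (1 - α) / (γ - (1 - α)))) ?_
    filter_upwards [ae_restrict_mem measurableSet_Ioo] with x hx
    exact abs_rightKernel_le hr (by simp [recenter]) (by linarith) hαγ hx
  · have e : ∫ x in Ioo 0 t, leftDeriv α 0 t (heaviside c) x *
        rightDeriv (1 - α) 0 t (recenter t g) x = ∫ x in Ioo (max 0 c) t,
        (1 / (Real.Gamma (1 - α) * Real.Gamma α)) *
          ((x - c) ^ ((1 - α) - 1) * rightKernel (1 - α) t (recenter t g) x) := by
      rw [← Ioo_inter_Ioi, ← setIntegral_indicator measurableSet_Ioi]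
      refine integral_congr_ae ?_
      filter_upwards [hd, ae_restrict_mem measurableSet_Ioo] with x hx hxm
      rw [hx, rightDeriv_eq hxm]
      by_cases hxc : x ∈ Ioi c
      · rw [indicator_of_mem hxc, indicator_of_mem hxc, show 1 - α - 1 = -α by ring]
        field_simp
      · rw [indicator_of_notMem hxc, indicator_of_notMem hxc, zero_mul]
    rw [glsIntegral, intervalIntegral.integral_of_le ht, integral_Ioc_eq_integral_Ioo, e,
      max_eq_right hc, integral_const_mul]
    rcases lt_or_ge c t with hct | hct
    · rw [integral_rightKernel h hγ (by linarith) hαγ hct, min_eq_left hct.le, sub_sub_cancel]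
      have := (Real.Gamma_pos_of_pos hα).ne'
      have := (Real.Gamma_pos_of_pos (sub_pos.2 hα1)).ne'
      field_simp
      ring
    · simp [Ioo_eq_empty_of_le hct, min_eq_right hct]

theorem hasGLS_sum {ι : Type*} {C γ α t : ℝ} {g : ℝ → ℝ} (h : HolderBound C γ g) (hγ : γ ≤ 1)
    (hα : 0 < α) (hα1 : α < 1) (hαγ : 1 - α < γ) (ht : 0 ≤ t) (s : Finset ι) (c : ι → ℝ)
    (u v : ι → ℝ) (hu : ∀ i ∈ s, 0 ≤ u i) (huv : ∀ i ∈ s, u i ≤ v i) :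
    HasGLS α t (fun x => ∑ i ∈ s, c i * (Ico (u i) (v i)).indicator 1 x) g
      (∑ i ∈ s, c i * (g (min (v i) t) - g (min (u i) t))) := by
  classical
  induction s using Finset.induction_on with
  | empty =>
    -- The zero integrand is obtained as the difference of a Heaviside function with itself.
    have h0 := hasGLS_heaviside h hγ hα hα1 hαγ le_rfl ht
    have := h0.add_const_mul (k := -1) ht h0
    simpa using this
  | insert i s hi ih =>
    have ih' := ih (fun j hj => hu j (Finset.mem_insert_of_mem hj))
      (fun j hj => huv j (Finset.mem_insert_of_mem hj))
    have hui := hu i (Finset.mem_insert_self i s)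
    have huvi := huv i (Finset.mem_insert_self i s)
    have h1 := hasGLS_heaviside h hγ hα hα1 hαγ hui ht
    have h2 := hasGLS_heaviside h hγ hα hα1 hαγ (hui.trans huvi) ht
    have h3 := (ih'.add_const_mul (k := c i) ht h1).add_const_mul (k := -c i) ht h2
    convert h3 using 1
    · ext x
      rw [Finset.sum_insert hi]
      have : (Ico (u i) (v i)).indicator 1 x = heaviside (u i) x - heaviside (v i) x := by
        rcases lt_or_ge x (u i) with hx | hx
        · rw [heaviside_of_lt hx, heaviside_of_lt (hx.trans_le huvi),
            indicator_of_notMem (fun h : x ∈ Ico (u i) (v i) => absurd h.1 (not_le.2 hx)), sub_self]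
        rcases lt_or_ge x (v i) with hx' | hx'
        · rw [heaviside_of_le hx, heaviside_of_lt hx',
            indicator_of_mem (show x ∈ Ico (u i) (v i) from ⟨hx, hx'⟩)]
          simp
        · rw [heaviside_of_le hx, heaviside_of_le hx',
            indicator_of_notMem (fun h : x ∈ Ico (u i) (v i) => absurd h.2 (not_lt.2 hx')), sub_self]
      rw [this]
      ring
    · rw [Finset.sum_insert hi]
      ring

/-! ### Hölder paths of Gaussian processes by dyadic chaining -/

variable {Ω : Type*} {m : MeasurableSpace Ω}

/-- The dyadic approximation of `t` from below at level `n`. -/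
def dyadicFloor (n : ℕ) (t : ℝ) : ℝ := (⌊2 ^ n * t⌋₊ : ℝ) / 2 ^ n

lemma dyadicFloor_mem {n : ℕ} {t : ℝ} (ht : t ∈ Icc (0 : ℝ) 1) : dyadicFloor n t ∈ Icc (0 : ℝ) 1 := by
  refine ⟨by unfold dyadicFloor; positivity, ?_⟩
  rw [dyadicFloor, div_le_one (by positivity)]
  refine (Nat.floor_le (mul_nonneg (by positivity) ht.1)).trans ?_
  exact mul_le_of_le_one_right (by positivity) ht.2

lemma tendsto_dyadicFloor {t : ℝ} (ht : 0 ≤ t) :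
    Tendsto (fun n => dyadicFloor n t) atTop (𝓝 t) := by
  have h := (tendsto_nat_floor_mul_div_atTop (R := ℝ) ht).comp
    (tendsto_pow_atTop_atTop_of_one_lt (one_lt_two : (1 : ℝ) < 2))
  refine h.congr fun n => ?_
  simp only [Function.comp, dyadicFloor, mul_comm t]

/-- Two points at distance at most `2 ^ (-n)` have equal or adjacent dyadic floors at level `n`. -/
lemma abs_dyadicFloor_sub_le {f : ℝ → ℝ} {a : ℕ → ℝ} (ha : ∀ n, 0 ≤ a n)
    (h : ∀ n k : ℕ, k < 2 ^ n → |f ((k + 1) / 2 ^ n) - f (k / 2 ^ n)| ≤ a n)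
    {s t : ℝ} (hs : 0 ≤ s) (hst : s ≤ t) (ht : t ≤ 1) {n : ℕ} (hn : t - s ≤ 1 / 2 ^ n) :
    |f (dyadicFloor n t) - f (dyadicFloor n s)| ≤ a n := by
  have h2 : (0 : ℝ) < 2 ^ n := by positivity
  have hle : ⌊2 ^ n * s⌋₊ ≤ ⌊2 ^ n * t⌋₊ := Nat.floor_le_floor (by gcongr)
  have hle2 : ⌊2 ^ n * t⌋₊ ≤ ⌊2 ^ n * s⌋₊ + 1 := by
    rw [← Nat.floor_add_one (by positivity)]
    refine Nat.floor_le_floor ?_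
    rw [le_div_iff₀ h2] at hn
    linarith
  rcases hle.eq_or_lt with he | hlt
  · simp [dyadicFloor, he, ha n]
  · have he : ⌊2 ^ n * t⌋₊ = ⌊2 ^ n * s⌋₊ + 1 := by omega
    have hlt2 : ⌊2 ^ n * s⌋₊ < 2 ^ n := by
      have h3 : (⌊2 ^ n * t⌋₊ : ℝ) ≤ 2 ^ n :=
        (Nat.floor_le (mul_nonneg h2.le (hs.trans hst))).trans (mul_le_of_le_one_right h2.le ht)
      have h4 : ⌊2 ^ n * t⌋₊ ≤ 2 ^ n := by exact_mod_cast h3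
      omega
    have := h n _ hlt2
    rw [dyadicFloor, dyadicFloor, he]
    push_cast
    exact this

/-- The floor at level `n` is also a dyadic point of level `n + 1`, at distance at most `2 ^ (-(n +
1))` from the finer floor, so the previous lemma applies at level `n + 1`. -/
lemma abs_dyadicFloor_succ_sub_le {f : ℝ → ℝ} {a : ℕ → ℝ} (ha : ∀ n, 0 ≤ a n)
    (h : ∀ n k : ℕ, k < 2 ^ n → |f ((k + 1) / 2 ^ n) - f (k / 2 ^ n)| ≤ a n)
    {t : ℝ} (ht : t ∈ Icc (0 : ℝ) 1) (n : ℕ) :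
    |f (dyadicFloor (n + 1) t) - f (dyadicFloor n t)| ≤ a (n + 1) := by
  have h2 : (0 : ℝ) < 2 ^ n := by positivity
  have hp : (0 : ℝ) ≤ 2 ^ n * t := mul_nonneg h2.le ht.1
  have e : dyadicFloor (n + 1) (dyadicFloor n t) = dyadicFloor n t := by
    have : (2 : ℝ) ^ (n + 1) * dyadicFloor n t = ((2 * ⌊2 ^ n * t⌋₊ : ℕ) : ℝ) := by
      rw [dyadicFloor]; push_cast; field_simp; ring
    rw [dyadicFloor, this, Nat.floor_natCast, dyadicFloor]
    push_cast
    field_simp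
    ring
  have hfl := Nat.floor_le hp
  have hle : dyadicFloor n t ≤ t := by
    rw [dyadicFloor, div_le_iff₀ h2]; linarith
  have hp' : (0 : ℝ) ≤ 2 ^ (n + 1) * t := mul_nonneg (by positivity) ht.1
  have e2 : dyadicFloor (n + 1) (dyadicFloor (n + 1) t) = dyadicFloor (n + 1) t := by
    have : (2 : ℝ) ^ (n + 1) * dyadicFloor (n + 1) t = (⌊2 ^ (n + 1) * t⌋₊ : ℝ) := by
      rw [dyadicFloor]; field_simp
    rw [dyadicFloor, this, Nat.floor_natCast, dyadicFloor]
  have hle1 : dyadicFloor n t ≤ dyadicFloor (n + 1) t := by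
    rw [← e]
    exact div_le_div_of_nonneg_right (Nat.cast_le.2 (Nat.floor_le_floor (by gcongr)))
      (by positivity)
  have hd : dyadicFloor (n + 1) t - dyadicFloor n t ≤ 1 / 2 ^ (n + 1) := by
    have h3 : 2 * ⌊2 ^ n * t⌋₊ + 1 ≥ ⌊2 ^ (n + 1) * t⌋₊ := by
      have h4 := Nat.lt_floor_add_one (2 ^ n * t)
      have h5 := Nat.floor_le hp'
      have h6 : (⌊2 ^ (n + 1) * t⌋₊ : ℝ) < 2 * (⌊2 ^ n * t⌋₊ + 1) := by
        rw [pow_succ] at h5 ⊢; linarith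
      have h7 : ⌊2 ^ (n + 1) * t⌋₊ < 2 * (⌊2 ^ n * t⌋₊ + 1) := by exact_mod_cast h6
      omega
    have h3' : (⌊2 ^ (n + 1) * t⌋₊ : ℝ) ≤ 2 * ⌊2 ^ n * t⌋₊ + 1 := by exact_mod_cast h3
    rw [dyadicFloor, dyadicFloor, pow_succ, sub_le_iff_le_add, div_add_div _ _ (by positivity)
      (by positivity), div_le_div_iff₀ (by positivity) (by positivity)]
    rw [pow_succ] at h3'
    have : (0 : ℝ) < 2 ^ n * 2 * (2 ^ n) := by positivity
    nlinarith
  have := abs_dyadicFloor_sub_le ha h (dyadicFloor_mem ht).1 hle1 (dyadicFloor_mem ht).2 hd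
  rwa [e, e2] at this

/-- A continuous function on `[0, 1]` with geometrically decaying dyadic increments is Hölder. -/
theorem abs_sub_le_of_dyadic {f : ℝ → ℝ} (hf : ContinuousOn f (Icc 0 1)) {B γ : ℝ} (hB : 0 ≤ B)
    (hγ : 0 < γ) (h : ∀ n k : ℕ, k < 2 ^ n →
      |f ((k + 1) / 2 ^ n) - f (k / 2 ^ n)| ≤ B * ((2 : ℝ) ^ (-γ)) ^ n)
    {s t : ℝ} (hs : s ∈ Icc (0 : ℝ) 1) (ht : t ∈ Icc (0 : ℝ) 1) :
    |f s - f t| ≤ B * (2 ^ γ * (1 + 2 * (2 ^ (-γ) / (1 - 2 ^ (-γ))))) * |s - t| ^ γ := by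
  wlog hst : s ≤ t generalizing s t
  · rw [abs_sub_comm, abs_sub_comm s]
    exact this ht hs (le_of_not_ge hst)
  set r : ℝ := 2 ^ (-γ) with hr
  have hr0 : 0 < r := by positivity
  have hr1 : r < 1 := Real.rpow_lt_one_of_one_lt_of_neg one_lt_two (by linarith)
  have ha : ∀ n : ℕ, 0 ≤ B * r ^ n := fun n => by positivity
  -- Chosen so that the sum of `B * r ^ m` over `m > n` is `D * r ^ n`.
  set D := B * (r / (1 - r)) with hD
  have hD0 : 0 ≤ D := mul_nonneg hB (div_nonneg hr0.le (by linarith))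
  have tail : ∀ x ∈ Icc (0 : ℝ) 1, ∀ n, |f x - f (dyadicFloor n x)| ≤ D * r ^ n := by
    intro x hx n
    have h1 : ∀ N, n ≤ N →
        |f (dyadicFloor N x) - f (dyadicFloor n x)| ≤ D * (r ^ n - r ^ N) := by
      intro N hN
      induction N, hN using Nat.le_induction with
      | base => simp
      | succ N hN ih =>
        have h2 := abs_dyadicFloor_succ_sub_le ha h hx N
        have h3 : D * (r ^ N - r ^ (N + 1)) = B * r ^ (N + 1) := by
          have : 1 - r ≠ 0 := by linarith
          rw [hD, pow_succ]
          field_simp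
        calc _ ≤ |f (dyadicFloor (N + 1) x) - f (dyadicFloor N x)| +
              |f (dyadicFloor N x) - f (dyadicFloor n x)| := abs_sub_le _ _ _
          _ ≤ B * r ^ (N + 1) + D * (r ^ n - r ^ N) := add_le_add h2 ih
          _ = _ := by rw [← h3]; ring
    have hlim : Tendsto (fun N => |f (dyadicFloor N x) - f (dyadicFloor n x)|) atTop
        (𝓝 |f x - f (dyadicFloor n x)|) := by
      have h4 : Tendsto (fun N => dyadicFloor N x) atTop (𝓝[Icc 0 1] x) :=
        tendsto_nhdsWithin_iff.2 ⟨tendsto_dyadicFloor hx.1,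
          Eventually.of_forall fun N => dyadicFloor_mem hx⟩
      exact (((hf x hx).tendsto.comp h4).sub_const _).abs
    refine le_of_tendsto hlim ?_
    filter_upwards [eventually_ge_atTop n] with N hN
    refine (h1 N hN).trans ?_
    have : 0 ≤ r ^ N := by positivity
    gcongr
    linarith
  rcases hst.eq_or_lt with rfl | hlt
  · simp only [sub_self, abs_zero]
    rw [Real.zero_rpow hγ.ne', mul_zero]
  -- The level with `2 ^ (-(n + 1)) < t - s ≤ 2 ^ (-n)`: the upper bound makes the floors adjacent,
  -- the lower one turns `r ^ n` into `(t - s) ^ γ` at the cost of a factor `2 ^ γ`.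
  obtain ⟨n, hn1, hn2⟩ := exists_nat_pow_near_of_lt_one (sub_pos.2 hlt)
    (by linarith [hs.1, ht.2] : t - s ≤ 1) (by norm_num : (0 : ℝ) < 1 / 2) (by norm_num)
  have hmid := abs_dyadicFloor_sub_le ha h hs.1 hst ht.2 (n := n) (by
    rw [← one_div_pow]; exact hn2)
  have htot : |f s - f t| ≤ B * (1 + 2 * (r / (1 - r))) * r ^ n := by
    have e : f s - f t = (f s - f (dyadicFloor n s)) - (f t - f (dyadicFloor n t)) -
      (f (dyadicFloor n t) - f (dyadicFloor n s)) := by ring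
    rw [e]
    calc _ ≤ |f s - f (dyadicFloor n s)| + |f t - f (dyadicFloor n t)| +
          |f (dyadicFloor n t) - f (dyadicFloor n s)| :=
          (abs_sub _ _).trans (add_le_add_left (abs_sub _ _) _)
      _ ≤ D * r ^ n + D * r ^ n + B * r ^ n :=
          add_le_add (add_le_add (tail s hs n) (tail t ht n)) hmid
      _ = _ := by rw [hD]; ring
  have hrn : r ^ n ≤ 2 ^ γ * (t - s) ^ γ := by
    have h5 : r ^ (n + 1) = ((1 / 2 : ℝ) ^ (n + 1)) ^ γ := by
      rw [hr, ← Real.rpow_natCast, ← Real.rpow_natCast, ← Real.rpow_mul (by norm_num),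
        ← Real.rpow_mul (by norm_num), one_div, Real.inv_rpow (by norm_num),
        ← Real.rpow_neg (by norm_num)]
      congr 1
      ring
    have h6 : r ^ (n + 1) ≤ (t - s) ^ γ := by
      rw [h5]
      gcongr
    have h7 : (2 : ℝ) ^ γ * r = 1 := by
      rw [hr, ← Real.rpow_add (by norm_num)]; simp
    calc r ^ n = 2 ^ γ * r ^ (n + 1) := by rw [pow_succ, mul_comm _ r, ← mul_assoc, h7, one_mul]
      _ ≤ _ := by gcongr
  rw [abs_sub_comm s t, abs_of_pos (sub_pos.2 hlt)]
  have : 0 ≤ r / (1 - r) := div_nonneg hr0.le (by linarith)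
  calc _ ≤ B * (1 + 2 * (r / (1 - r))) * r ^ n := htot
    _ ≤ B * (1 + 2 * (r / (1 - r))) * (2 ^ γ * (t - s) ^ γ) := by gcongr
    _ = _ := by ring

/-- A centered Gaussian variable has the law of its standard deviation times a standard normal one,
so `A` is the absolute moment of the latter and serves all variables at once. -/
lemma exists_lintegral_enorm_pow_le (p : ℕ) : ∃ A : ℝ≥0∞, A < ∞ ∧
    ∀ {Ω : Type*} {_ : MeasurableSpace Ω} (P : Measure Ω) (X : Ω → ℝ) (σ : ℝ), 0 ≤ σ →
      HasGaussianLaw X P → ∫ ω, X ω ∂P = 0 → ∫ ω, |X ω| ^ 2 ∂P ≤ σ ^ 2 →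
      ∫⁻ ω, ‖X ω‖ₑ ^ p ∂P ≤ ENNReal.ofReal σ ^ p * A := by
  refine ⟨∫⁻ x, ‖x‖ₑ ^ p ∂(gaussianReal 0 1), ?_, ?_⟩
  · rcases p.eq_zero_or_pos with rfl | hp
    · simp
    have := (memLp_id_gaussianReal' (μ := 0) (v := 1) (p : ℝ≥0∞) (by simp)).eLpNorm_lt_top
    rw [eLpNorm_lt_top_iff_lintegral_rpow_enorm_lt_top (by simpa using hp.ne') (by simp)] at this
    simpa using this
  · intro Ω m P X σ hσ hX h0 h2
    have hlaw := hX.map_eq_gaussianReal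
    have hvar : Var[X; P] = ∫ ω, |X ω| ^ 2 ∂P := by
      rw [variance_eq_integral hX.aemeasurable, h0]
      simp
    set s := √(Var[X; P]) with hs
    have hs0 : 0 ≤ s := Real.sqrt_nonneg _
    have hsσ : s ≤ σ := Real.sqrt_le_iff.2 ⟨hσ, hvar ▸ h2⟩
    have hlaw2 : P.map X = (gaussianReal 0 1).map (s * ·) := by
      rw [hlaw, h0, gaussianReal_map_const_mul, mul_zero, mul_one]
      congr 1
      ext
      rw [Real.coe_toNNReal _ (variance_nonneg _ _)]
      change _ = s ^ 2
      rw [hs, Real.sq_sqrt (variance_nonneg _ _)]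
    have hm : Measurable fun x : ℝ => ‖x‖ₑ ^ p := by fun_prop
    calc ∫⁻ ω, ‖X ω‖ₑ ^ p ∂P = ∫⁻ x, ‖x‖ₑ ^ p ∂(P.map X) :=
          (lintegral_map' hm.aemeasurable hX.aemeasurable).symm
      _ = ∫⁻ x, ‖s * x‖ₑ ^ p ∂(gaussianReal 0 1) := by
          rw [hlaw2, lintegral_map hm (by fun_prop)]
      _ = ENNReal.ofReal s ^ p * ∫⁻ x, ‖x‖ₑ ^ p ∂(gaussianReal 0 1) := by
          rw [← lintegral_const_mul _ hm]
          refine lintegral_congr fun x => ?_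
          rw [enorm_mul, mul_pow, Real.enorm_of_nonneg hs0]
      _ ≤ _ := by gcongr

/-- A continuous centered Gaussian process with incremental variance of order `2H` has
`γ`-Hölder paths for `γ < H`, with a measurable Hölder constant. -/
theorem exists_holder_constant {P : Measure Ω} {T H γ C : ℝ} (hT : 0 < T) (hγ : 0 < γ)
    (hγH : γ < H) {G : ℝ → Ω → ℝ}
    (hG_gauss : IsGaussianProcess (fun t : Set.Icc (0 : ℝ) T => G t) P)
    (hG_centered : ∀ t ∈ Set.Icc 0 T, ∫ ω, G t ω ∂P = 0)
    (hG_cont : ∀ᵐ ω ∂P, ContinuousOn (fun t => G t ω) (Set.Icc 0 T))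
    (hG_meas : ∀ t ∈ Set.Icc 0 T, Measurable (G t))
    (hC : ∀ s ∈ Icc 0 T, ∀ t ∈ Icc 0 T, ∫ ω, |G t ω - G s ω| ^ 2 ∂P ≤ C * |t - s| ^ (2 * H)) :
    ∃ K : Ω → ℝ, Measurable K ∧ ∀ᵐ ω ∂P, ∀ s ∈ Icc 0 T, ∀ t ∈ Icc 0 T,
      |G s ω - G t ω| ≤ K ω * |s - t| ^ γ := by
  -- With `p (H - γ) > 1` the moment bound outweighs the number `2 ^ n` of increments at level `n`.
  obtain ⟨p, hp⟩ := exists_nat_gt (1 / (H - γ))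
  have hHγ : 0 < H - γ := sub_pos.2 hγH
  have hp1 : 1 < p * (H - γ) := by rwa [div_lt_iff₀ hHγ] at hp
  have hp0 : p ≠ 0 := by
    rintro rfl
    norm_num at hp1
  have hpr : (p : ℝ) ≠ 0 := by exact_mod_cast hp0
  obtain ⟨A, hA, hmom⟩ := exists_lintegral_enorm_pow_le p
  have hmem : ∀ n k : ℕ, k ≤ 2 ^ n → T * (k / 2 ^ n) ∈ Icc 0 T := by
    intro n k hk
    refine ⟨by positivity, mul_le_of_le_one_right hT.le ?_⟩
    rw [div_le_one (by positivity)]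
    exact_mod_cast hk
  set Δ : ℕ → ℕ → Ω → ℝ := fun n k ω =>
    if k < 2 ^ n then G (T * ((k + 1) / 2 ^ n)) ω - G (T * (k / 2 ^ n)) ω else 0 with hΔ
  have hmem' : ∀ n k : ℕ, k < 2 ^ n → T * (((k : ℝ) + 1) / 2 ^ n) ∈ Icc 0 T := by
    intro n k hk
    exact_mod_cast hmem n (k + 1) hk
  have hΔm : ∀ n k, Measurable (Δ n k) := by
    intro n k
    by_cases hk : k < 2 ^ n
    · simp only [hΔ, if_pos hk]
      exact (hG_meas _ (hmem' n k hk)).sub (hG_meas _ (hmem n k hk.le))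
    · simp only [hΔ, if_neg hk]
      exact measurable_const
  set a : ℝ := 2 ^ γ with ha
  set b : ℝ := 2 ^ (-H) with hb
  have ha0 : 0 < a := by positivity
  have hb0 : 0 < b := by positivity
  -- The absolute value replaces a sign hypothesis on `C`.
  set S : ℝ := √(|C| * T ^ (2 * H)) with hS
  have hmoment : ∀ n k, k < 2 ^ n →
      ∫⁻ ω, ‖Δ n k ω‖ₑ ^ p ∂P ≤ ENNReal.ofReal (S * b ^ n) ^ p * A := by
    intro n k hk
    have hΔe : Δ n k = fun ω => G (T * ((k + 1) / 2 ^ n)) ω - G (T * (k / 2 ^ n)) ω := by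
      ext ω
      simp only [hΔ, if_pos hk]
    rw [hΔe]
    have i1 := (hG_gauss.hasGaussianLaw_eval ⟨_, hmem' n k hk⟩).integrable
    have i2 := (hG_gauss.hasGaussianLaw_eval ⟨_, hmem n k hk.le⟩).integrable
    refine hmom P _ (S * b ^ n) (by positivity) (hG_gauss.hasGaussianLaw_fun_sub
      (s := ⟨_, hmem' n k hk⟩) (t := ⟨_, hmem n k hk.le⟩)) ?_ ?_
    · rw [integral_sub i1 i2, hG_centered _ (hmem' n k hk), hG_centered _ (hmem n k hk.le),
        sub_zero]
    · refine (hC _ (hmem n k hk.le) _ (hmem' n k hk)).trans ?_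
      have e1 : T * (((k : ℝ) + 1) / 2 ^ n) - T * (k / 2 ^ n) = T * (1 / 2) ^ n := by
        rw [one_div_pow]; field_simp; ring
      have e2 : (((1 : ℝ) / 2) ^ n) ^ (2 * H) = (b ^ n) ^ 2 := by
        rw [hb, ← Real.rpow_natCast, ← Real.rpow_natCast, ← Real.rpow_natCast,
          ← Real.rpow_mul (by positivity), ← Real.rpow_mul (by positivity),
          ← Real.rpow_mul (by positivity), one_div, Real.inv_rpow (by norm_num),
          ← Real.rpow_neg (by norm_num)]
        congr 1
        push_cast
        ring
      rw [e1, abs_of_pos (by positivity), Real.mul_rpow hT.le (by positivity), e2, mul_pow, hS,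
        Real.sq_sqrt (by positivity), ← mul_assoc]
      gcongr
      exact le_abs_self C
  -- A measurable quantity dominating the `p`-th power of every dyadic increment rescaled by `2 ^ (γ
  -- n)`; it is almost surely finite because its expectation is.
  set Z : Ω → ℝ≥0∞ := fun ω => ∑' n : ℕ, ∑ k ∈ Finset.range (2 ^ n),
    ENNReal.ofReal (a ^ n) ^ p * ‖Δ n k ω‖ₑ ^ p with hZ
  have hZm : Measurable Z := by
    refine Measurable.tsum fun n => Finset.measurable_sum _ fun k _ => ?_
    have := hΔm n k
    fun_prop
  have hZfin : ∀ᵐ ω ∂P, Z ω < ∞ := by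
    refine ae_lt_top hZm (ne_of_lt ?_)
    -- The geometric ratio: `2` counts increments, `a ^ p` is the weight and `b ^ p` the decay of
    -- the moments.
    set q : ℝ := 2 * (a * b) ^ p with hq
    have hq0 : 0 < q := by positivity
    have hq1 : q < 1 := by
      have : q = 2 ^ (1 - p * (H - γ)) := by
        rw [hq, ha, hb, ← Real.rpow_add (by norm_num), ← Real.rpow_natCast,
          ← Real.rpow_mul (by norm_num)]
        nth_rewrite 1 [← Real.rpow_one 2]
        rw [← Real.rpow_add (by norm_num)]
        congr 1
        ring
      rw [this]
      exact Real.rpow_lt_one_of_one_lt_of_neg one_lt_two (by linarith)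
    have hterm : ∀ n : ℕ, ∫⁻ ω, ∑ k ∈ Finset.range (2 ^ n),
        ENNReal.ofReal (a ^ n) ^ p * ‖Δ n k ω‖ₑ ^ p ∂P ≤
        (ENNReal.ofReal S ^ p * A) * ENNReal.ofReal q ^ n := by
      intro n
      rw [lintegral_finsetSum _ fun k _ => by
        have := hΔm n k
        fun_prop]
      have h1 : ∀ k ∈ Finset.range (2 ^ n), ∫⁻ ω, ENNReal.ofReal (a ^ n) ^ p * ‖Δ n k ω‖ₑ ^ p ∂P ≤
          ENNReal.ofReal (a ^ n) ^ p * (ENNReal.ofReal (S * b ^ n) ^ p * A) := by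
        intro k hk
        rw [lintegral_const_mul _ (by have := hΔm n k; fun_prop)]
        gcongr
        exact hmoment n k (Finset.mem_range.1 hk)
      refine (Finset.sum_le_sum h1).trans (le_of_eq ?_)
      rw [Finset.sum_const, Finset.card_range, nsmul_eq_mul, ENNReal.ofReal_mul (by positivity),
        hq, ENNReal.ofReal_mul (by positivity), ENNReal.ofReal_pow (by positivity),
        ENNReal.ofReal_pow (by positivity), ENNReal.ofReal_pow (by positivity),
        ENNReal.ofReal_mul (by positivity)]
      push_cast
      rw [ENNReal.ofReal_ofNat]
      ring
    calc ∫⁻ ω, Z ω ∂P = ∑' n : ℕ, ∫⁻ ω, ∑ k ∈ Finset.range (2 ^ n),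
        ENNReal.ofReal (a ^ n) ^ p * ‖Δ n k ω‖ₑ ^ p ∂P := by
          refine lintegral_tsum fun n => (Finset.measurable_sum _ fun k _ => ?_).aemeasurable
          have := hΔm n k
          fun_prop
      _ ≤ ∑' n : ℕ, (ENNReal.ofReal S ^ p * A) * ENNReal.ofReal q ^ n :=
          ENNReal.tsum_le_tsum hterm
      _ < ∞ := by
          rw [ENNReal.tsum_mul_left, ENNReal.tsum_geometric]
          refine ENNReal.mul_lt_top
            (ENNReal.mul_lt_top (ENNReal.pow_lt_top ENNReal.ofReal_lt_top) hA) ?_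
          rw [ENNReal.inv_lt_top, tsub_pos_iff_lt]
          exact ENNReal.ofReal_lt_one.2 hq1
  -- The chaining constant for the path rescaled to `[0, 1]`; the factor `(T ^ γ)⁻¹` undoes the
  -- rescaling.
  refine ⟨fun ω => ((Z ω).toReal ^ (1 / (p : ℝ))) *
    (2 ^ γ * (1 + 2 * (2 ^ (-γ) / (1 - 2 ^ (-γ))))) * (T ^ γ)⁻¹, by fun_prop, ?_⟩
  filter_upwards [hZfin, hG_cont] with ω hω hcont s hs t ht
  have hZr : ∀ n k : ℕ, k < 2 ^ n → (a ^ n * |Δ n k ω|) ^ p ≤ (Z ω).toReal := by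
    intro n k hk
    have h1 : ENNReal.ofReal (a ^ n) ^ p * ‖Δ n k ω‖ₑ ^ p ≤ Z ω :=
      (Finset.single_le_sum (f := fun k => ENNReal.ofReal (a ^ n) ^ p * ‖Δ n k ω‖ₑ ^ p)
        (fun _ _ => zero_le) (Finset.mem_range.2 hk)).trans (ENNReal.le_tsum n)
    have h2 := ENNReal.toReal_mono hω.ne h1
    rw [← mul_pow, ENNReal.toReal_pow, ENNReal.toReal_mul, toReal_enorm,
      ENNReal.toReal_ofReal (by positivity)] at h2
    exact h2
  have hscale : ∀ x ∈ Icc 0 T, x / T ∈ Icc (0 : ℝ) 1 := fun x hx =>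
    ⟨div_nonneg hx.1 hT.le, (div_le_one hT).2 hx.2⟩
  have hc : ContinuousOn (fun x => G (T * x) ω) (Icc 0 1) :=
    hcont.comp (by fun_prop) fun x hx =>
      ⟨mul_nonneg hT.le hx.1, mul_le_of_le_one_right hT.le hx.2⟩
  have key := abs_sub_le_of_dyadic hc (B := (Z ω).toReal ^ (1 / (p : ℝ))) (by positivity) hγ (by
    intro n k hk
    have h1 : a ^ n * |Δ n k ω| ≤ (Z ω).toReal ^ (1 / (p : ℝ)) := by
      rw [one_div, Real.le_rpow_inv_iff_of_pos (by positivity) (by positivity) (by positivity),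
        Real.rpow_natCast]
      exact hZr n k hk
    have h2 : a * 2 ^ (-γ) = 1 := by rw [ha, ← Real.rpow_add (by norm_num)]; simp
    have h3 : Δ n k ω = G (T * ((k + 1) / 2 ^ n)) ω - G (T * (k / 2 ^ n)) ω := by
      simp only [hΔ, if_pos hk]
    rw [← h3]
    calc |Δ n k ω| = (a ^ n * |Δ n k ω|) * ((2 : ℝ) ^ (-γ)) ^ n := by
          rw [mul_right_comm, ← mul_pow, h2, one_pow, one_mul]
      _ ≤ _ := by gcongr) (hscale s hs) (hscale t ht)
  rw [mul_div_cancel₀ _ hT.ne', mul_div_cancel₀ _ hT.ne', ← sub_div, abs_div, abs_of_pos hT,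
    Real.div_rpow (abs_nonneg _) hT.le] at key
  refine key.trans (le_of_eq ?_)
  ring

/-! ### Stopped left-point sums -/

/-- The integral on `[0, t]` of the step function with value `c j` on `[u j, u (j + 1))`, `j < M`,
with respect to `g`. -/
def stepIntegral (M : ℕ) (u c : ℕ → ℝ) (g : ℝ → ℝ) (t : ℝ) : ℝ :=
  ∑ j ∈ Finset.range M, c j * (g (min (u (j + 1)) t) - g (min (u j) t))

/-- The left-point sums approximating `N (g (u j) - g (u 0)) ^ 2`. -/
def leftSum (N : ℝ) (u : ℕ → ℝ) (g : ℝ → ℝ) (j : ℕ) : ℝ :=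
  ∑ i ∈ Finset.range j, 2 * N * (g (u i) - g (u 0)) * (g (u (i + 1)) - g (u i))

/-- The integrand of `leftSum`, stopped when the sum reaches the level `y`. -/
def stoppedCoeff (N y : ℝ) (u : ℕ → ℝ) (g : ℝ → ℝ) (j : ℕ) : ℝ :=
  open Classical in
  if ∀ i ∈ Finset.range (j + 1), leftSum N u g i < y then 2 * N * (g (u j) - g (u 0)) else 0

/-- Summation of `2 x (y - x) = y² - x² - (y - x)²`, a discrete chain rule for the square. -/
lemma leftSum_eq (N : ℝ) (u : ℕ → ℝ) (g : ℝ → ℝ) (j : ℕ) : leftSum N u g j =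
    N * (g (u j) - g (u 0)) ^ 2 - N * ∑ i ∈ Finset.range j, (g (u (i + 1)) - g (u i)) ^ 2 := by
  induction j with
  | zero => simp [leftSum]
  | succ j ih =>
    rw [leftSum, Finset.sum_range_succ, ← leftSum, ih, Finset.sum_range_succ]
    ring

/-- The index `i` is the first time the sum reaches `y`, or `j` if this has not happened before. -/
lemma exists_stopped_eq (N y : ℝ) (u : ℕ → ℝ) (g : ℝ → ℝ) (j : ℕ) : ∃ i ≤ j,
    ∑ k ∈ Finset.range j, stoppedCoeff N y u g k * (g (u (k + 1)) - g (u k)) = leftSum N u g i ∧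
      (∀ k < i, leftSum N u g k < y) ∧ (y ≤ leftSum N u g i ∨ i = j) := by
  induction j with
  | zero => exact ⟨0, le_rfl, by simp [leftSum], by simp, Or.inr rfl⟩
  | succ j ih =>
    obtain ⟨i, hij, hV, hlt, hor⟩ := ih
    rw [Finset.sum_range_succ, hV]
    by_cases hy : y ≤ leftSum N u g i
    · refine ⟨i, hij.trans j.le_succ, ?_, hlt, Or.inl hy⟩
      rw [stoppedCoeff, if_neg, zero_mul, add_zero]
      intro h
      exact absurd (h i (Finset.mem_range.2 (by omega))) (not_lt.2 hy)
    · have hi : i = j := hor.resolve_left hy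
      subst hi
      have hall : ∀ k ∈ Finset.range (i + 1), leftSum N u g k < y := by
        intro k hk
        rcases (Nat.lt_succ_iff.1 (Finset.mem_range.1 hk)).lt_or_eq with h | rfl
        · exact hlt k h
        · exact not_le.1 hy
      refine ⟨i + 1, le_rfl, ?_, fun k hk => hall k (Finset.mem_range.2 hk), Or.inr rfl⟩
      rw [stoppedCoeff, if_pos hall, leftSum, leftSum, Finset.sum_range_succ]

lemma exists_mem_subinterval {u : ℕ → ℝ} {M : ℕ} (hM : 0 < M) {t : ℝ} (ht : t ∈ Icc (u 0) (u M)) :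
    ∃ j < M, t ∈ Icc (u j) (u (j + 1)) := by
  induction M, hM using Nat.le_induction with
  | base => exact ⟨0, by simp, by simpa using ht⟩
  | succ M hM ih =>
    rcases le_total t (u M) with h | h
    · obtain ⟨j, hj, hjt⟩ := ih ⟨ht.1, h⟩
      exact ⟨j, by omega, hjt⟩
    · exact ⟨M, by omega, h, ht.2⟩

lemma stepIntegral_of_mem {M : ℕ} {u c : ℕ → ℝ} {g : ℝ → ℝ} (hu : Monotone u) {j : ℕ} (hj : j < M)
    {t : ℝ} (ht : t ∈ Icc (u j) (u (j + 1))) : stepIntegral M u c g t =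
      ∑ k ∈ Finset.range j, c k * (g (u (k + 1)) - g (u k)) + c j * (g t - g (u j)) := by
  have h1 : Finset.range (j + 1) ⊆ Finset.range M := Finset.range_subset_range.2 hj
  rw [stepIntegral, ← Finset.sum_subset h1, Finset.sum_range_succ, min_eq_right ht.2,
    min_eq_left ht.1]
  · congr 1
    refine Finset.sum_congr rfl fun k hk => ?_
    have hk' := Finset.mem_range.1 hk
    rw [min_eq_left ((hu (by omega : k + 1 ≤ j)).trans ht.1),
      min_eq_left ((hu (by omega : k ≤ j)).trans ht.1)]
  · intro k _ hk
    have hk' : j + 1 ≤ k := by simpa using hk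
    rw [min_eq_right (ht.2.trans (hu (by omega : j + 1 ≤ k + 1))),
      min_eq_right (ht.2.trans (hu hk')), sub_self, mul_zero]

lemma stepIntegral_of_ge {M : ℕ} {u c : ℕ → ℝ} {g : ℝ → ℝ} (hu : Monotone u) {t : ℝ}
    (ht : u M ≤ t) : stepIntegral M u c g t =
      ∑ k ∈ Finset.range M, c k * (g (u (k + 1)) - g (u k)) := by
  refine Finset.sum_congr rfl fun k hk => ?_
  have hk' := Finset.mem_range.1 hk
  rw [min_eq_left ((hu (by omega : k + 1 ≤ M)).trans ht),
    min_eq_left ((hu (by omega : k ≤ M)).trans ht)]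

/-- The sum stays above `-ε` because a square minus a small quadratic variation does, and overshoots
`y` by at most one step. By `h3` the unstopped sum would end above `y`, so the level is reached.
Between partition points the value moves by at most a further `ε`. -/
lemma stoppedCoeff_stepIntegral_bound {M : ℕ} {u : ℕ → ℝ} {g : ℝ → ℝ} {N y ε : ℝ} (hM : 0 < M)
    (hu : Monotone u) (hN : 0 ≤ N) (hy : 0 ≤ y)
    (h1 : ∀ j < M, ∀ t ∈ Icc (u j) (u (j + 1)),
      |2 * N * (g (u j) - g (u 0)) * (g t - g (u j))| ≤ ε)
    (h2 : N * ∑ i ∈ Finset.range M, (g (u (i + 1)) - g (u i)) ^ 2 ≤ ε)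
    (h3 : y + ε ≤ N * (g (u M) - g (u 0)) ^ 2) :
    (∀ t ∈ Icc (u 0) (u M), |stepIntegral M u (stoppedCoeff N y u g) g t| ≤ y + 2 * ε) ∧
      |stepIntegral M u (stoppedCoeff N y u g) g (u M) - y| ≤ ε := by
  have hε : 0 ≤ ε := (abs_nonneg _).trans (h1 0 hM (u 0) ⟨le_rfl, hu (Nat.zero_le _)⟩)
  have hlow : ∀ i ≤ M, -ε ≤ leftSum N u g i := by
    intro i hi
    rw [leftSum_eq]
    have h4 : ∑ i ∈ Finset.range i, (g (u (i + 1)) - g (u i)) ^ 2 ≤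
        ∑ i ∈ Finset.range M, (g (u (i + 1)) - g (u i)) ^ 2 :=
      Finset.sum_le_sum_of_subset_of_nonneg (Finset.range_subset_range.2 hi)
        fun _ _ _ => sq_nonneg _
    have h5 := mul_le_mul_of_nonneg_left h4 hN
    have h6 : 0 ≤ N * (g (u i) - g (u 0)) ^ 2 := by positivity
    linarith
  have hup : ∀ i ≤ M, (∀ k < i, leftSum N u g k < y) → leftSum N u g i ≤ y + ε := by
    intro i hi h
    rcases i with _ | i
    · simp only [leftSum, Finset.range_zero, Finset.sum_empty]
      linarith
    · have h5 := (abs_le.1 (h1 i hi (u (i + 1)) ⟨hu i.le_succ, le_rfl⟩)).2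
      have h6 := h i i.lt_succ_self
      rw [leftSum, Finset.sum_range_succ, ← leftSum]
      linarith
  constructor
  · intro t ht
    obtain ⟨j, hj, hjt⟩ := exists_mem_subinterval hM ht
    obtain ⟨i, hij, hV, hlt, -⟩ := exists_stopped_eq N y u g j
    rw [stepIntegral_of_mem hu hj hjt, hV]
    have h4 : |stoppedCoeff N y u g j * (g t - g (u j))| ≤ ε := by
      rw [stoppedCoeff]
      split_ifs
      · exact h1 j hj t hjt
      · simpa using hε
    have h5 := hlow i (by omega)
    have h6 := hup i (by omega) hlt
    rw [abs_le] at h4 ⊢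
    constructor <;> linarith
  · obtain ⟨i, hij, hV, hlt, hor⟩ := exists_stopped_eq N y u g M
    rw [stepIntegral_of_ge hu le_rfl, hV]
    have h6 := hup i hij hlt
    have h7 : y ≤ leftSum N u g i := by
      rcases hor with h | rfl
      · exact h
      · rw [leftSum_eq]
        linarith
    rw [abs_le]
    constructor <;> linarith

lemma stepIntegral_const_mul {M : ℕ} {u c : ℕ → ℝ} {g : ℝ → ℝ} (k t : ℝ) :
    stepIntegral M u (fun j => k * c j) g t = k * stepIntegral M u c g t := by
  rw [stepIntegral, stepIntegral, Finset.mul_sum]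
  exact Finset.sum_congr rfl fun _ _ => by ring

/-! ### Steering the integral on one interval -/

lemma exists_nat_measure_le {P : Measure Ω} [IsFiniteMeasure P] {X : Ω → ℝ} (hX : Measurable X)
    {δ : ℝ≥0∞} (hδ : 0 < δ) : ∃ n : ℕ, P {ω | (n : ℝ) ≤ X ω} ≤ δ := by
  have h := tendsto_measure_iInter_atTop (μ := P) (s := fun n : ℕ => {ω | (n : ℝ) ≤ X ω})
    (fun n => (measurableSet_le measurable_const hX).nullMeasurableSet)
    (fun i j hij ω (hω : (j : ℝ) ≤ X ω) =>
      (le_trans (Nat.cast_le.2 hij) hω : (i : ℝ) ≤ X ω)) ⟨0, measure_ne_top _ _⟩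
  have he : ⋂ n : ℕ, {ω | (n : ℝ) ≤ X ω} = ∅ := by
    refine eq_empty_of_forall_notMem fun ω hω => ?_
    obtain ⟨n, hn⟩ := exists_nat_gt (X ω)
    exact absurd (mem_iInter.1 hω n) (not_le.2 hn)
  rw [he, measure_empty] at h
  obtain ⟨n, hn⟩ := (h.eventually_lt_const hδ).exists
  exact ⟨n, hn.le⟩

/-- A fine uniform partition makes the one-step sums and the quadratic variation of a Hölder
function small. -/
lemma exists_fine_partition {a b γ N k ε : ℝ} (hab : a < b) (hγ : 1 / 2 < γ) (hN : 0 ≤ N)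
    (hk : 0 ≤ k) (hε : 0 < ε) : ∃ (M : ℕ) (u : ℕ → ℝ), 0 < M ∧ Monotone u ∧ u 0 = a ∧ u M = b ∧
      ∀ g : ℝ → ℝ, (∀ s ∈ Icc a b, ∀ t ∈ Icc a b, |g s - g t| ≤ k * |s - t| ^ γ) →
        (∀ j < M, ∀ t ∈ Icc (u j) (u (j + 1)),
          |2 * N * (g (u j) - g (u 0)) * (g t - g (u j))| ≤ ε) ∧
        N * ∑ i ∈ Finset.range M, (g (u (i + 1)) - g (u i)) ^ 2 ≤ ε := by
  have hγ0 : 0 < γ := by linarith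
  have l1 : Tendsto (fun M : ℕ => 2 * N * (k * (b - a) ^ γ) * (k * (b - a) ^ γ) *
      (M : ℝ) ^ (-γ)) atTop (𝓝 0) := by
    have := ((tendsto_rpow_neg_atTop hγ0).comp tendsto_natCast_atTop_atTop).const_mul
      (2 * N * (k * (b - a) ^ γ) * (k * (b - a) ^ γ))
    simpa using this
  -- Adding `M` squared increments of order `M ^ (-2γ)` leaves `M ^ (-(2γ - 1))`, which tends to
  -- zero because `γ > 1/2`.
  have l2 : Tendsto (fun M : ℕ => N * (k * (b - a) ^ γ) ^ 2 * (M : ℝ) ^ (-(2 * γ - 1)))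
      atTop (𝓝 0) := by
    have := ((tendsto_rpow_neg_atTop (y := 2 * γ - 1) (by linarith)).comp
      tendsto_natCast_atTop_atTop).const_mul (N * (k * (b - a) ^ γ) ^ 2)
    simpa using this
  obtain ⟨M, hM1, hM2, hM⟩ := ((l1.eventually_lt_const hε).and
    ((l2.eventually_lt_const hε).and (eventually_gt_atTop 0))).exists
  have hM0 : (0 : ℝ) < M := by exact_mod_cast hM
  have hba : 0 < b - a := sub_pos.2 hab
  set h := (b - a) / M with hh
  have hh0 : 0 < h := by positivity
  have hhγ : h ^ γ = (b - a) ^ γ * (M : ℝ) ^ (-γ) := by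
    rw [hh, Real.div_rpow hba.le hM0.le, Real.rpow_neg hM0.le, div_eq_mul_inv]
  have hmono : Monotone fun j : ℕ => a + j * h := fun i j hij => by
    have : (i : ℝ) ≤ j := by exact_mod_cast hij
    simp only
    gcongr
  have hu0 : a + ((0 : ℕ) : ℝ) * h = a := by simp
  have huM : a + (M : ℝ) * h = b := by rw [hh]; field_simp; ring
  refine ⟨M, fun j => a + j * h, hM, hmono, hu0, huM, fun g hg => ?_⟩
  have hmem : ∀ j ≤ M, a + (j : ℝ) * h ∈ Icc a b := fun j hj => by
    constructor
    · have : 0 ≤ (j : ℝ) * h := by positivity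
      linarith
    · rw [← huM]; exact hmono hj
  have hstep : ∀ j < M, ∀ t ∈ Icc (a + (j : ℝ) * h) (a + ((j + 1 : ℕ) : ℝ) * h),
      |g t - g (a + j * h)| ≤ k * h ^ γ := by
    intro j hj t ht
    have h1 := hmem j hj.le
    have h2 := hmem (j + 1) hj
    refine (hg t ⟨h1.1.trans ht.1, ht.2.trans h2.2⟩ _ h1).trans ?_
    gcongr
    rw [abs_of_nonneg (sub_nonneg.2 ht.1)]
    have := ht.2
    push_cast at this
    linarith
  constructor
  · intro j hj t ht
    have h1 : |g (a + j * h) - g a| ≤ k * (b - a) ^ γ := by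
      refine (hg _ (hmem j hj.le) a ⟨le_rfl, hab.le⟩).trans ?_
      have := (hmem j hj.le).2
      gcongr
      rw [abs_of_nonneg (sub_nonneg.2 (hmem j hj.le).1)]
      linarith
    simp only [hu0]
    rw [abs_mul, abs_mul, abs_of_nonneg (by positivity : 0 ≤ 2 * N)]
    calc 2 * N * |g (a + j * h) - g a| * |g t - g (a + j * h)|
        ≤ 2 * N * (k * (b - a) ^ γ) * (k * h ^ γ) := by
          gcongr
          exact hstep j hj t ht
      _ = 2 * N * (k * (b - a) ^ γ) * (k * (b - a) ^ γ) * (M : ℝ) ^ (-γ) := by rw [hhγ]; ring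
      _ ≤ ε := hM1.le
  · have h1 : ∀ i ∈ Finset.range M,
        (g (a + ((i + 1 : ℕ) : ℝ) * h) - g (a + i * h)) ^ 2 ≤ (k * h ^ γ) ^ 2 := by
      intro i hi
      rw [← sq_abs]
      gcongr
      exact hstep i (Finset.mem_range.1 hi) _ ⟨hmono i.le_succ, le_rfl⟩
    have h2 := Finset.sum_le_sum h1
    rw [Finset.sum_const, Finset.card_range, nsmul_eq_mul] at h2
    have h3 : (M : ℝ) * ((M : ℝ) ^ (-γ)) ^ 2 = (M : ℝ) ^ (-(2 * γ - 1)) := by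
      nth_rewrite 1 [← Real.rpow_one (M : ℝ)]
      rw [← Real.rpow_natCast, ← Real.rpow_mul hM0.le, ← Real.rpow_add hM0]
      congr 1
      push_cast
      ring
    calc _ ≤ N * (M * (k * h ^ γ) ^ 2) := mul_le_mul_of_nonneg_left h2 hN
      _ = N * (k * (b - a) ^ γ) ^ 2 * (M * ((M : ℝ) ^ (-γ)) ^ 2) := by rw [hhγ]; ring
      _ ≤ ε := by rw [h3]; exact hM2.le

/-- The stopping test at `j` involves the path only at `u 0, ..., u j`. The σ-algebra is a free
variable here so that it can be taken to be `𝓕` at time `u j`. -/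
lemma measurable_sign_mul_stoppedCoeff {Ω : Type*} {m : MeasurableSpace Ω} {G : ℝ → Ω → ℝ}
    {Y : Ω → ℝ} {N : ℝ} {u : ℕ → ℝ} {j : ℕ} (hY : Measurable Y)
    (hG : ∀ i ≤ j, Measurable (G (u i))) : Measurable fun ω =>
      (SignType.sign (Y ω) : ℝ) * stoppedCoeff N |Y ω| u (fun s => G s ω) j := by
  have hS : ∀ i ≤ j, Measurable fun ω => leftSum N u (fun s => G s ω) i := by
    intro i hi
    refine Finset.measurable_fun_sum _ fun l hl => ?_
    have hl' := Finset.mem_range.1 hl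
    exact (((hG l (by omega)).sub (hG 0 (Nat.zero_le _))).const_mul _).mul
      ((hG (l + 1) (by omega)).sub (hG l (by omega)))
  refine Measurable.mul ?_ ?_
  · have hs : Measurable fun y : ℝ => ((SignType.sign y : SignType) : ℝ) := by
      have : (fun y : ℝ => ((SignType.sign y : SignType) : ℝ)) =
          fun y : ℝ => if 0 < y then 1 else if y < 0 then -1 else 0 := by
        ext y
        simp only [sign_apply]
        split_ifs <;> simp
      rw [this]
      exact Measurable.ite measurableSet_Ioi measurable_const
        (Measurable.ite measurableSet_Iio measurable_const measurable_const)
    exact hs.comp hY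
  · refine Measurable.ite ?_ (((hG j le_rfl).sub (hG 0 (Nat.zero_le _))).const_mul _)
      measurable_const
    have : {ω | ∀ i ∈ Finset.range (j + 1), leftSum N u (fun s => G s ω) i < |Y ω|} =
        ⋂ i ∈ Finset.range (j + 1), {ω | leftSum N u (fun s => G s ω) i < |Y ω|} := by
      ext ω; simp
    rw [this]
    exact Finset.measurableSet_biInter _ fun i hi =>
      measurableSet_lt (hS i (Nat.lt_succ_iff.1 (Finset.mem_range.1 hi))) hY.abs

/-- On `[a, b]`, an adapted step integrand steers the integral close to a prescribed
`𝓕 a`-measurable value, up to an event of small probability, and without large excursions. -/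
theorem exists_steering_block {P : Measure Ω} [IsFiniteMeasure P] {T γ : ℝ} (hγ : 1 / 2 < γ)
    {𝓕 : Filtration (Icc (0 : ℝ) T) m} {G : ℝ → Ω → ℝ}
    (hG : Adapted 𝓕 fun t : Icc (0 : ℝ) T => G t) {K : Ω → ℝ} (hK : Measurable K)
    (hKG : ∀ᵐ ω ∂P, ∀ s ∈ Icc 0 T, ∀ t ∈ Icc 0 T, |G s ω - G t ω| ≤ K ω * |s - t| ^ γ)
    {a b : ℝ} (ha : 0 ≤ a) (hab : a < b) (hb : b ≤ T) (hne : ∀ᵐ ω ∂P, G b ω ≠ G a ω)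
    {Y : Ω → ℝ} (hY : Measurable[𝓕 ⟨a, ha, hab.le.trans hb⟩] Y) {ε : ℝ} (hε : 0 < ε)
    {δ : ℝ≥0∞} (hδ : 0 < δ) :
    ∃ (M : ℕ) (u : ℕ → ℝ) (c : ℕ → Ω → ℝ), Monotone u ∧ u 0 = a ∧ u M = b ∧
      (∀ j, ∀ hj : u j ∈ Icc 0 T, Measurable[𝓕 ⟨u j, hj⟩] (c j)) ∧
      ∃ B : Set Ω, P B ≤ δ ∧ ∀ ω ∉ B,
        (∀ t ∈ Icc a b, |stepIntegral M u (fun j => c j ω) (fun s => G s ω) t| ≤ |Y ω| + ε) ∧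
        |stepIntegral M u (fun j => c j ω) (fun s => G s ω) b - Y ω| ≤ ε := by
  have haT : a ∈ Icc 0 T := ⟨ha, hab.le.trans hb⟩
  have hbT : b ∈ Icc 0 T := ⟨ha.trans hab.le, hb⟩
  have hGm : ∀ s ∈ Icc 0 T, ∀ t : Icc (0 : ℝ) T, s ≤ t → Measurable[𝓕 t] (G s) :=
    fun s hs t hst => (hG ⟨s, hs⟩).mono (𝓕.mono hst) le_rfl
  have hYm : Measurable Y := hY.mono (𝓕.le _) le_rfl
  have hGa : Measurable (G a) := (hG ⟨a, haT⟩).mono (𝓕.le _) le_rfl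
  have hGb : Measurable (G b) := (hG ⟨b, hbT⟩).mono (𝓕.le _) le_rfl
  have hδ2 : 0 < δ / 2 := ENNReal.half_pos hδ.ne'
  -- Off an event of probability at most `δ`, the Hölder constant is below a deterministic `k`, and
  -- `N` times the squared increment over `[a, b]` exceeds `|Y| + ε / 2`. The partition then depends
  -- only on `k` and `N`, hence is deterministic.
  obtain ⟨k, hk⟩ := exists_nat_measure_le (P := P) hK hδ2
  obtain ⟨N, hN⟩ := exists_nat_measure_le (P := P)
    (X := fun ω => (|Y ω| + ε / 2) / (G b ω - G a ω) ^ 2) (by fun_prop) hδ2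
  obtain ⟨M, u, hM, hu, hu0, huM, hgood⟩ := exists_fine_partition (N := N) (k := k) hab hγ
    (Nat.cast_nonneg N) (Nat.cast_nonneg k) (half_pos hε)
  refine ⟨M, u, fun j ω => SignType.sign (Y ω) * stoppedCoeff N |Y ω| u (fun s => G s ω) j,
    hu, hu0, huM, ?_, ?_⟩
  · intro j hj
    have haj : a ≤ u j := hu0 ▸ hu (Nat.zero_le j)
    have hYj : Measurable[𝓕 ⟨u j, hj⟩] Y := hY.mono (𝓕.mono haj) le_rfl
    have hGj : ∀ i ≤ j, Measurable[𝓕 ⟨u j, hj⟩] (G (u i)) := fun i hi =>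
      hGm (u i) ⟨ha.trans (hu0 ▸ hu (Nat.zero_le i)), (hu hi).trans hj.2⟩ _ (hu hi)
    exact measurable_sign_mul_stoppedCoeff hYj hGj
  · refine ⟨({ω | (k : ℝ) ≤ K ω} ∪ {ω | (N : ℝ) ≤ (|Y ω| + ε / 2) / (G b ω - G a ω) ^ 2}) ∪
      {ω | ¬ ((∀ s ∈ Icc 0 T, ∀ t ∈ Icc 0 T, |G s ω - G t ω| ≤ K ω * |s - t| ^ γ) ∧
        G b ω ≠ G a ω)}, ?_, ?_⟩
    · have h0 := ae_iff.1 (hKG.and hne)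
      refine (measure_union_le _ _).trans ?_
      rw [h0, add_zero]
      refine (measure_union_le _ _).trans ?_
      rw [← ENNReal.add_halves δ]
      exact add_le_add hk hN
    · intro ω hω
      simp only [mem_union, mem_ofPred_eq, not_or, not_le, not_not] at hω
      obtain ⟨⟨hω1, hω2⟩, hω3, hω4⟩ := hω
      have hsub : Icc a b ⊆ Icc 0 T := Icc_subset_Icc ha hb
      obtain ⟨g1, g2⟩ := hgood (fun s => G s ω) fun s hs t ht => by
        refine (hω3 s (hsub hs) t (hsub ht)).trans ?_
        gcongr
      have hsq : 0 < (G b ω - G a ω) ^ 2 := by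
        have := sub_ne_zero.2 hω4
        positivity
      have g3 : |Y ω| + ε / 2 ≤ N * (G (u M) ω - G (u 0) ω) ^ 2 := by
        rw [hu0, huM]
        rw [div_lt_iff₀ hsq] at hω2
        exact hω2.le
      obtain ⟨b1, b2⟩ := stoppedCoeff_stepIntegral_bound (g := fun s => G s ω) hM hu
        (Nat.cast_nonneg N) (abs_nonneg (Y ω)) g1 g2 g3
      rw [hu0, huM] at b1
      rw [huM] at b2
      have hsign : |((SignType.sign (Y ω) : SignType) : ℝ)| ≤ 1 := by
        rcases lt_trichotomy (Y ω) 0 with h | h | h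
        · simp [sign_neg h]
        · simp [h]
        · simp [sign_pos h]
      constructor
      · intro t ht
        rw [stepIntegral_const_mul, abs_mul]
        refine (mul_le_of_le_one_left (abs_nonneg _) hsign).trans ?_
        have := b1 t ht
        linarith
      · rw [stepIntegral_const_mul]
        have e : ∀ V : ℝ, (SignType.sign (Y ω) : ℝ) * V - Y ω =
            (SignType.sign (Y ω) : ℝ) * (V - |Y ω|) := fun V => by
          rw [mul_sub, sign_mul_abs]
        rw [e, abs_mul]
        refine (mul_le_of_le_one_left (abs_nonneg _) hsign).trans ?_
        linarith

/-! ### Targets and successive blocks up to the end time -/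

/-- A sequence of times increasing to `T`. -/
def gridTime (T : ℝ) (n : ℕ) : ℝ := T - T * (1 / 2) ^ n

lemma gridTime_zero (T : ℝ) : gridTime T 0 = 0 := by simp [gridTime]

lemma gridTime_lt {T : ℝ} (hT : 0 < T) (n : ℕ) : gridTime T n < T := by
  have : 0 < T * (1 / 2) ^ n := by positivity
  unfold gridTime; linarith

lemma strictMono_gridTime {T : ℝ} (hT : 0 < T) : StrictMono (gridTime T) :=
  strictMono_nat_of_lt_succ fun n => by
    have : 0 < T * (1 / 2) ^ n := by positivity
    unfold gridTime
    rw [pow_succ]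
    linarith

lemma gridTime_nonneg {T : ℝ} (hT : 0 < T) (n : ℕ) : 0 ≤ gridTime T n :=
  gridTime_zero T ▸ (strictMono_gridTime hT).monotone (Nat.zero_le n)

lemma gridTime_mem {T : ℝ} (hT : 0 < T) (n : ℕ) : gridTime T n ∈ Icc 0 T :=
  ⟨gridTime_nonneg hT n, (gridTime_lt hT n).le⟩

lemma tendsto_gridTime (T : ℝ) : Tendsto (gridTime T) atTop (𝓝 T) := by
  have := ((tendsto_pow_atTop_nhds_zero_of_lt_one (r := (1 / 2 : ℝ)) (by norm_num)
    (by norm_num)).const_mul T).const_sub T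
  rw [mul_zero, sub_zero] at this
  exact this

lemma exists_lt_gridTime {T t : ℝ} (ht : t < T) : ∃ n, t < gridTime T n :=
  ((tendsto_gridTime T).eventually_const_lt ht).exists

/-- A random variable measurable before the end time is the almost sure limit of random variables
measurable at the grid times. -/
theorem exists_adapted_approximation {P : Measure Ω} [IsFiniteMeasure P] {T : ℝ} (hT : 0 < T)
    {𝓕 : Filtration (Icc (0 : ℝ) T) m} {ξ : Ω → ℝ} (hξ : Measurable[sigmaBeforeEnd 𝓕] ξ) :
    ∃ X : ℕ → Ω → ℝ, (∀ n, Measurable[𝓕 ⟨gridTime T n, gridTime_mem hT n⟩] (X n)) ∧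
      ∀ᵐ ω ∂P, Tendsto (fun n => X n ω) atTop (𝓝 (ξ ω)) := by
  let ℱ : Filtration ℕ m :=
    { seq := fun n => 𝓕 ⟨gridTime T n, gridTime_mem hT n⟩
      mono' := fun i j hij => 𝓕.mono ((strictMono_gridTime hT).monotone hij)
      le' := fun n => 𝓕.le _ }
  have hle : sigmaBeforeEnd 𝓕 ≤ ⨆ n, ℱ n := by
    refine iSup₂_le fun t ht => ?_
    obtain ⟨n, hn⟩ := exists_lt_gridTime ht
    exact (𝓕.mono (j := ⟨gridTime T n, gridTime_mem hT n⟩) hn.le).trans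
      (le_iSup (fun n => (ℱ n : MeasurableSpace Ω)) n)
  have hle' : ⨆ n, (ℱ n : MeasurableSpace Ω) ≤ m := iSup_le fun n => ℱ.le n
  -- No integrability of `ξ` is available, so the martingale convergence theorem is applied to the
  -- bounded variable `arctan ξ`.
  have hmeas : Measurable[⨆ n, (ℱ n : MeasurableSpace Ω)] fun ω => Real.arctan (ξ ω) :=
    Real.continuous_arctan.measurable.comp (hξ.mono hle le_rfl)
  have hint : Integrable (fun ω => Real.arctan (ξ ω)) P := by
    refine Integrable.of_bound (hmeas.mono hle' le_rfl).aestronglyMeasurable (Real.pi / 2)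
      (ae_of_all _ fun ω => ?_)
    rw [Real.norm_eq_abs, abs_le]
    exact ⟨(Real.neg_pi_div_two_lt_arctan _).le, (Real.arctan_lt_pi_div_two _).le⟩
  have htan : Measurable Real.tan := by
    have : Real.tan = fun x => Real.sin x / Real.cos x := funext Real.tan_eq_sin_div_cos
    rw [this]
    fun_prop
  -- The tangent is measurable everywhere and continuous at the limit `arctan (ξ ω)`, which lies
  -- strictly between `-π/2` and `π/2`; this suffices.
  refine ⟨fun n ω => Real.tan ((P[fun ω => Real.arctan (ξ ω)|ℱ n]) ω), fun n =>
    htan.comp stronglyMeasurable_condExp.measurable, ?_⟩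
  filter_upwards [hint.tendsto_ae_condExp hmeas.stronglyMeasurable] with ω hω
  have h := (Real.continuousAt_tan.2 (Real.cos_arctan_pos (ξ ω)).ne').tendsto.comp hω
  rwa [Real.tan_arctan] at h

lemma ae_ne_zero_of_hasGaussianLaw {P : Measure Ω} {X : Ω → ℝ} (hX : HasGaussianLaw X P)
    (h0 : ∫ ω, X ω ∂P = 0) (h2 : 0 < ∫ ω, |X ω| ^ 2 ∂P) : ∀ᵐ ω ∂P, X ω ≠ 0 := by
  have hvar : Var[X; P] = ∫ ω, |X ω| ^ 2 ∂P := by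
    rw [variance_eq_integral hX.aemeasurable, h0]
    simp
  have hlaw := hX.map_eq_gaussianReal
  have : NullSingletonClass (P.map X) := by
    rw [hlaw]
    exact nullSingletonClass_gaussianReal (Real.toNNReal_pos.2 (hvar ▸ h2)).ne'
  exact ae_of_ae_map hX.aemeasurable (Measure.ae_ne (P.map X) 0)

/-- A sequence of adapted step integrands on the consecutive grid intervals, whose accumulated
integrals `I n` follow the targets `X n`. -/
theorem exists_steering_blocks {P : Measure Ω} [IsFiniteMeasure P] {T γ : ℝ} (hT : 0 < T)
    (hγ : 1 / 2 < γ) {𝓕 : Filtration (Icc (0 : ℝ) T) m} {G : ℝ → Ω → ℝ}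
    (hG : Adapted 𝓕 fun t : Icc (0 : ℝ) T => G t) {K : Ω → ℝ} (hK : Measurable K)
    (hKG : ∀ᵐ ω ∂P, ∀ s ∈ Icc 0 T, ∀ t ∈ Icc 0 T, |G s ω - G t ω| ≤ K ω * |s - t| ^ γ)
    (hne : ∀ a ∈ Icc 0 T, ∀ b ∈ Icc 0 T, a < b → ∀ᵐ ω ∂P, G b ω ≠ G a ω)
    {X : ℕ → Ω → ℝ} (hX : ∀ n, Measurable[𝓕 ⟨gridTime T n, gridTime_mem hT n⟩] (X n)) :
    ∃ (M : ℕ → ℕ) (u : ℕ → ℕ → ℝ) (c : ℕ → ℕ → Ω → ℝ) (I : ℕ → Ω → ℝ),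
      (∀ n, Monotone (u n)) ∧ (∀ n, u n 0 = gridTime T n) ∧
      (∀ n, u n (M n) = gridTime T (n + 1)) ∧
      (∀ n j, ∀ hj : u n j ∈ Icc 0 T, Measurable[𝓕 ⟨u n j, hj⟩] (c n j)) ∧
      (∀ ω, I 0 ω = 0) ∧
      (∀ n ω, I (n + 1) ω = I n ω + stepIntegral (M n) (u n) (fun j => c n j ω)
        (fun s => G s ω) (gridTime T (n + 1))) ∧
      ∀ᵐ ω ∂P, ∀ᶠ n in atTop,
        (∀ t ∈ Icc (gridTime T n) (gridTime T (n + 1)),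
          |stepIntegral (M n) (u n) (fun j => c n j ω) (fun s => G s ω) t| ≤
            |X n ω - I n ω| + (1 / 2) ^ n) ∧
        |I (n + 1) ω - X n ω| ≤ (1 / 2) ^ n := by
  -- The accumulated integral `J` is arbitrary at this stage, and block `n` steers towards `X n -
  -- J`. Failure probabilities `2 ^ (-n)` are summable, for Borel–Cantelli.
  have hstep := fun (n : ℕ)
      (J : {J : Ω → ℝ // Measurable[𝓕 ⟨gridTime T n, gridTime_mem hT n⟩] J}) =>
    exists_steering_block (P := P) hγ hG hK hKG (gridTime_nonneg hT n)
      (strictMono_gridTime hT n.lt_succ_self) (gridTime_lt hT (n + 1)).le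
      (hne _ (gridTime_mem hT n) _ (gridTime_mem hT (n + 1))
        (strictMono_gridTime hT n.lt_succ_self))
      (Y := fun ω => X n ω - J.1 ω) (@Measurable.sub _ _ _ _ _ (_) _ _ (hX n) J.2)
      (ε := (1 / 2) ^ n) (by positivity) (δ := (2⁻¹ : ℝ≥0∞) ^ n) (by
        exact ENNReal.pow_pos (by simp) n)
  choose M u c hu hu0 huM hc B hB hgood using hstep
  have hnext : ∀ (n : ℕ)
      (J : {J : Ω → ℝ // Measurable[𝓕 ⟨gridTime T n, gridTime_mem hT n⟩] J}),
      Measurable[𝓕 ⟨gridTime T (n + 1), gridTime_mem hT (n + 1)⟩] fun ω => J.1 ω +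
        stepIntegral (M n J) (u n J) (fun j => c n J j ω) (fun s => G s ω)
          (gridTime T (n + 1)) := by
    intro n J
    have hmono := (strictMono_gridTime hT).monotone n.le_succ
    have e : ∀ ω, stepIntegral (M n J) (u n J) (fun j => c n J j ω) (fun s => G s ω)
        (gridTime T (n + 1)) = ∑ k ∈ Finset.range (M n J),
          c n J k ω * (G (u n J (k + 1)) ω - G (u n J k) ω) := fun ω =>
      stepIntegral_of_ge (hu n J) (huM n J).le
    simp only [e]
    refine @Measurable.add _ _ _ _ _ (_) _ _ (J.2.mono (𝓕.mono hmono) le_rfl) ?_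
    refine @Finset.measurable_fun_sum _ _ _ _ _ _ (_) _ _ fun k hk => ?_
    have hk' := Finset.mem_range.1 hk
    have hmem : ∀ i ≤ M n J, u n J i ∈ Icc 0 (gridTime T (n + 1)) := fun i hi =>
      ⟨(gridTime_nonneg hT n).trans (hu0 n J ▸ hu n J (Nat.zero_le i)), huM n J ▸ hu n J hi⟩
    have hmem' : ∀ i ≤ M n J, u n J i ∈ Icc 0 T := fun i hi =>
      ⟨(hmem i hi).1, (hmem i hi).2.trans (gridTime_lt hT (n + 1)).le⟩
    have hGi : ∀ i ≤ M n J,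
        Measurable[𝓕 ⟨gridTime T (n + 1), gridTime_mem hT (n + 1)⟩] (G (u n J i)) := fun i hi =>
      (hG ⟨_, hmem' i hi⟩).mono (𝓕.mono (hmem i hi).2) le_rfl
    refine @Measurable.mul _ _ _ _ _ (_) _ _
      ((hc n J k (hmem' k hk'.le)).mono (𝓕.mono (hmem k hk'.le).2) le_rfl) ?_
    exact @Measurable.sub _ _ _ _ _ (_) _ _ (hGi (k + 1) hk') (hGi k hk'.le)
  -- The recursion carries the measurability of the accumulated integral at time `t_n`, without
  -- which the next block cannot be chosen.
  let I : (n : ℕ) → {J : Ω → ℝ // Measurable[𝓕 ⟨gridTime T n, gridTime_mem hT n⟩] J} := fun n =>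
    Nat.rec ⟨fun _ => 0, @measurable_const _ _ _ (_) _⟩ (fun n J => ⟨_, hnext n J⟩) n
  have hI : ∀ n ω, (I (n + 1)).1 ω = (I n).1 ω + stepIntegral (M n (I n)) (u n (I n))
      (fun j => c n (I n) j ω) (fun s => G s ω) (gridTime T (n + 1)) := fun n ω => rfl
  refine ⟨fun n => M n (I n), fun n => u n (I n), fun n => c n (I n), fun n => (I n).1,
    fun n => hu n _, fun n => hu0 n _, fun n => huM n _, fun n => hc n _, fun ω => rfl, hI, ?_⟩
  have hsum : ∑' n, P (B n (I n)) ≠ ∞ := by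
    refine ne_of_lt ((ENNReal.tsum_le_tsum fun n => hB n (I n)).trans_lt ?_)
    rw [ENNReal.tsum_geometric, ENNReal.one_sub_inv_two, inv_inv]
    simp
  filter_upwards [ae_eventually_notMem hsum] with ω hω
  filter_upwards [hω] with n hn
  obtain ⟨h1, h2⟩ := hgood n (I n) ω hn
  refine ⟨h1, ?_⟩
  rw [hI]
  convert h2 using 2
  ring

/-! ### Assembling the blocks and passing to the limit -/

/-- The step process assembled from the blocks. -/
def blockProcess (M : ℕ → ℕ) (u : ℕ → ℕ → ℝ) (c : ℕ → ℕ → ℝ) (L : ℕ) (s : ℝ) : ℝ :=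
  ∑ n ∈ Finset.range L, ∑ j ∈ Finset.range (M n),
    c n j * (Ico (u n j) (u n (j + 1))).indicator 1 s

/-- Blocks from index `L` on live to the right of `gridTime T L`, so every finite truncation beyond
`s` gives the same value. -/
lemma blockProcess_eq_of_lt {T : ℝ} (hT : 0 < T) {M : ℕ → ℕ} {u : ℕ → ℕ → ℝ} {c : ℕ → ℕ → ℝ}
    (hu : ∀ n, Monotone (u n)) (hu0 : ∀ n, u n 0 = gridTime T n) {L L' : ℕ} {s : ℝ}
    (hL : s < gridTime T L) (hL' : s < gridTime T L') :
    blockProcess M u c L s = blockProcess M u c L' s := by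
  wlog h : L ≤ L' generalizing L L'
  · exact (this hL' hL (le_of_not_ge h)).symm
  refine Finset.sum_subset (Finset.range_subset_range.2 h) fun n _ hn => ?_
  refine Finset.sum_eq_zero fun j _ => ?_
  have hn' : L ≤ n := by simpa using hn
  have : s < u n j := hL.trans_le (((strictMono_gridTime hT).monotone hn').trans
    (hu0 n ▸ hu n (Nat.zero_le j)))
  rw [indicator_of_notMem (fun h : s ∈ Ico _ _ => absurd h.1 (not_le.2 this)), mul_zero]

/-- The integral of the block process, for a path which is Hölder on `[0, T]`. -/
theorem blockProcess_integral {T C γ α : ℝ} (hT : 0 < T) {M : ℕ → ℕ} {u : ℕ → ℕ → ℝ}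
    {c : ℕ → ℕ → ℝ} (hu : ∀ n, Monotone (u n)) (hu0 : ∀ n, u n 0 = gridTime T n)
    {g : ℝ → ℝ} (hg : ∀ s ∈ Icc 0 T, ∀ t ∈ Icc 0 T, |g s - g t| ≤ C * |s - t| ^ γ)
    (hγ : γ ≤ 1) (hα : 0 < α) (hα1 : α < 1) (hαγ : 1 - α < γ) {ψ : ℝ → ℝ}
    (hψ : ∀ L s, s < gridTime T L → ψ s = blockProcess M u c L s) {t : ℝ} (ht0 : 0 ≤ t) {L : ℕ}
    (htL : t ≤ gridTime T L) :
    FiniteFracNorm α 0 t ψ ∧ GLSIntegrable α 0 t ψ g ∧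
      glsIntegral α 0 t ψ g = ∑ n ∈ Finset.range L, stepIntegral (M n) (u n) (c n) g t := by
  have htT : t ≤ T := htL.trans (gridTime_lt hT L).le
  -- Freezing the path outside `[0, T]` makes it globally Hölder; the integral over `[0, t]` does
  -- not see the change.
  set g' : ℝ → ℝ := fun x => g (projIcc 0 T hT.le x) with hg'
  have hgg : ∀ x ∈ Icc 0 T, g' x = g x := fun x hx => by simp only [hg', projIcc_of_mem hT.le hx]
  have hC : 0 ≤ C := by
    have h1 := (abs_nonneg _).trans (hg 0 ⟨le_rfl, hT.le⟩ T ⟨hT.le, le_rfl⟩)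
    refine nonneg_of_mul_nonneg_left h1 (Real.rpow_pos_of_pos ?_ _)
    simpa using hT.ne'
  have hH : HolderBound C γ g' := fun x y => by
    refine (hg _ (projIcc 0 T hT.le x).2 _ (projIcc 0 T hT.le y).2).trans ?_
    have hγ0 : 0 ≤ γ := by linarith
    gcongr ?_ * ?_ ^ _
    exact abs_projIcc_sub_projIcc hT.le
  have hu_nonneg : ∀ n j, 0 ≤ u n j := fun n j =>
    (gridTime_nonneg hT n).trans (hu0 n ▸ hu n (Nat.zero_le j))
  have key := hasGLS_sum (t := t) hH hγ hα hα1 hαγ ht0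
    ((Finset.range L).sigma fun n => Finset.range (M n)) (fun i => c i.1 i.2)
    (fun i => u i.1 i.2) (fun i => u i.1 (i.2 + 1)) (fun i _ => hu_nonneg _ _)
    (fun i _ => hu _ (Nat.le_succ _))
  simp only [Finset.sum_sigma] at key
  have hf : EqOn (blockProcess M u c L) ψ (Ioo 0 t) := fun s hs =>
    (hψ L s (hs.2.trans_le htL)).symm
  have hgt : EqOn g' g (Ioc 0 t) := fun x hx => hgg x ⟨hx.1.le, hx.2.trans htT⟩
  refine ⟨⟨?_, ?_⟩, key.integrable.congr hf hgt, ?_⟩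
  · refine key.measurable.aemeasurable.congr ?_
    filter_upwards [ae_restrict_mem measurableSet_Ioo] with s hs using hf hs
  · rw [← fracNorm_congr hf]
    exact key.fracNorm_lt
  · rw [← glsIntegral_congr hf hgt ht0]
    refine key.integral_eq.trans ?_
    refine Finset.sum_congr rfl fun n _ => Finset.sum_congr rfl fun j _ => ?_
    rw [hgg _ ⟨le_min (hu_nonneg _ _) ht0, (min_le_right _ _).trans htT⟩,
      hgg _ ⟨le_min (hu_nonneg _ _) ht0, (min_le_right _ _).trans htT⟩]

/-- The accumulated integrals converge as soon as they follow a convergent sequence of targets. -/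
theorem tendsto_of_steering {T x : ℝ} (hT : 0 < T) {X I : ℕ → ℝ} {V : ℕ → ℝ → ℝ} {J : ℝ → ℝ}
    (hX : Tendsto X atTop (𝓝 x))
    (hJ : ∀ n, ∀ t ∈ Icc (gridTime T n) (gridTime T (n + 1)), J t = I n + V n t)
    (hgood : ∀ᶠ n in atTop,
      (∀ t ∈ Icc (gridTime T n) (gridTime T (n + 1)), |V n t| ≤ |X n - I n| + (1 / 2) ^ n) ∧
      |I (n + 1) - X n| ≤ (1 / 2) ^ n) :
    Tendsto J (𝓝[<] T) (𝓝 x) := by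
  have hpow : Tendsto (fun n : ℕ => (1 / 2 : ℝ) ^ n) atTop (𝓝 0) :=
    tendsto_pow_atTop_nhds_zero_of_lt_one (by norm_num) (by norm_num)
  have h1 : Tendsto (fun n => I (n + 1) - X n) atTop (𝓝 0) :=
    squeeze_zero_norm' (hgood.mono fun n hn => hn.2) hpow
  have h2 : Tendsto I atTop (𝓝 x) := by
    rw [← tendsto_add_atTop_iff_nat 1]
    simpa using h1.add hX
  -- This dominates the distance from `J t` to `x` throughout block `n`: one `|X n - I n|` comes
  -- from the excursion bound, the other from the gap between `I n` and `X n`.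
  have h3 : Tendsto (fun n => 2 * |X n - I n| + (1 / 2) ^ n + |X n - x|) atTop (𝓝 0) := by
    have := (((hX.sub h2).abs.const_mul 2).add hpow).add ((hX.sub_const x).abs)
    simpa using this
  rw [Metric.tendsto_nhds]
  intro η hη
  obtain ⟨n₀, hn₀⟩ := eventually_atTop.1 ((h3.eventually_lt_const hη).and hgood)
  filter_upwards [Ioo_mem_nhdsLT (gridTime_lt hT n₀)] with t ht
  have hex : ∃ n, t < gridTime T (n + 1) := by
    obtain ⟨n, hn⟩ := exists_lt_gridTime ht.2
    exact ⟨n, hn.trans (strictMono_gridTime hT n.lt_succ_self)⟩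
  classical
  -- The block containing `t`: the least `n` with `t < gridTime T (n + 1)`, so `gridTime T n ≤ t`
  -- follows by minimality.
  set n := Nat.find hex with hn
  have hlt : t < gridTime T (n + 1) := Nat.find_spec hex
  have hn0 : n₀ ≤ n := by
    by_contra hcon
    exact absurd (ht.1.trans hlt)
      (not_lt.2 ((strictMono_gridTime hT).monotone (by omega : n + 1 ≤ n₀)))
  have hle : gridTime T n ≤ t := by
    rcases hn0.eq_or_lt with h | h
    · rw [← h]; exact ht.1.le
    · by_contra hcon
      have := Nat.find_min hex (m := n - 1) (by omega)
      rw [show n - 1 + 1 = n by omega] at this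
      exact this (not_le.1 hcon)
  obtain ⟨hsmall, hV, -⟩ := hn₀ n hn0
  have hVt := hV t ⟨hle, hlt.le⟩
  rw [Real.dist_eq, hJ n t ⟨hle, hlt.le⟩]
  refine lt_of_le_of_lt ?_ hsmall
  calc |I n + V n t - x| = |V n t - (X n - I n) + (X n - x)| := by ring_nf
    _ ≤ |V n t| + |X n - I n| + |X n - x| :=
        (abs_add_le _ _).trans (add_le_add_left (abs_sub _ _) _)
    _ ≤ _ := by linarith

end PathwiseIntegral

end

/-! ### The representation theorem -/

theorem mainTheorem3 {Ω : Type*} {m : MeasurableSpace Ω} (P : Measure Ω) [IsProbabilityMeasure P]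
    (T : ℝ) (hT : 0 < T) (H : ℝ) (hH : H ∈ Set.Ioo (1 / 2 : ℝ) 1)
    (𝓕 : Filtration (Set.Icc (0 : ℝ) T) m) (h𝓕 : PathwiseIntegral.UsualConditions 𝓕 P)
    (G : ℝ → Ω → ℝ)
    (hG_gauss : IsGaussianProcess (fun t : Set.Icc (0 : ℝ) T => G t) P)
    (hG_centered : ∀ t ∈ Set.Icc 0 T, ∫ ω, G t ω ∂P = 0)
    (hG_cont : ∀ᵐ ω ∂P, ContinuousOn (fun t => G t ω) (Set.Icc 0 T))
    (hG_adapted : Adapted 𝓕 (fun t : Set.Icc (0 : ℝ) T => G t))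
    (hA : PathwiseIntegral.ConditionA H T G P)
    (hB : PathwiseIntegral.ConditionB T G P)
    (ξ : Ω → ℝ) (hξ : Measurable[PathwiseIntegral.sigmaBeforeEnd 𝓕] ξ) :
    ∃ ψ : ℝ → Ω → ℝ, Adapted 𝓕 (fun t : Set.Icc (0 : ℝ) T => ψ t) ∧
      ∃ α ∈ Set.Ioo (1 - H) (1 / 2 : ℝ), ∀ᵐ ω ∂P,
        (∀ t ∈ Set.Ico 0 T,
          PathwiseIntegral.FiniteFracNorm α 0 t (fun s => ψ s ω) ∧
          PathwiseIntegral.GLSIntegrable α 0 t (fun s => ψ s ω) (fun s => G s ω)) ∧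
        Tendsto (fun t => PathwiseIntegral.glsIntegral α 0 t (fun s => ψ s ω) (fun s => G s ω))
          (𝓝[<] T) (𝓝 (ξ ω)) := by
  open PathwiseIntegral in
  obtain ⟨hH1, hH2⟩ := hH
  obtain ⟨C₁, C₂, hC₁, hC₂, hvar⟩ := hA
  obtain ⟨α, hα1, hα2⟩ := exists_between (show 1 - H < 1 / 2 by linarith)
  -- From `1 - α < γ < H` with `α < 1/2`: the lower bound makes the right derivative of order `1 -
  -- α` bounded and forces `γ > 1/2`, the upper one gives Hölder paths.
  obtain ⟨γ, hγ1, hγ2⟩ := exists_between (show 1 - α < H by linarith)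
  have hG_meas : ∀ t ∈ Set.Icc 0 T, Measurable (G t) := fun t ht =>
    (hG_adapted ⟨t, ht⟩).mono (𝓕.le _) le_rfl
  obtain ⟨K, hK, hKG⟩ := exists_holder_constant (P := P) hT (by linarith) hγ2 hG_gauss hG_centered
    hG_cont hG_meas fun s hs t ht => (hvar s hs t ht).2
  -- The lower variance bound makes the Gaussian increment nondegenerate, so its law has no atom at
  -- zero.
  have hne : ∀ a ∈ Set.Icc 0 T, ∀ b ∈ Set.Icc 0 T, a < b → ∀ᵐ ω ∂P, G b ω ≠ G a ω := by
    intro a ha b hb hab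
    have i1 := (hG_gauss.hasGaussianLaw_eval ⟨a, ha⟩).integrable
    have i2 := (hG_gauss.hasGaussianLaw_eval ⟨b, hb⟩).integrable
    have h := ae_ne_zero_of_hasGaussianLaw
      (hG_gauss.hasGaussianLaw_fun_sub (s := ⟨b, hb⟩) (t := ⟨a, ha⟩))
      (by rw [integral_sub i2 i1, hG_centered a ha, hG_centered b hb, sub_zero])
      (lt_of_lt_of_le (by
        have := Real.rpow_pos_of_pos (abs_pos.2 (sub_ne_zero.2 hab.ne')) (2 * H)
        positivity) (hvar a ha b hb).1)
    filter_upwards [h] with ω hω using sub_ne_zero.1 hω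
  obtain ⟨X, hXm, hX⟩ := exists_adapted_approximation (P := P) hT hξ
  obtain ⟨M, u, c, I, hu, hu0, huM, hc, hI0, hI, hgood⟩ :=
    exists_steering_blocks hT (by linarith) hG_adapted hK hKG hne hXm
  have hN : ∀ t : ℝ, t < T → ∃ n, t < gridTime T n := fun t ht => exists_lt_gridTime ht
  -- For `t ≥ T` the value of `N t` is arbitrary. This affects neither the integrals on `[0, t]`
  -- with `t < T` nor adaptedness at `T`.
  choose! N hN using hN
  refine ⟨fun t ω => blockProcess M u (fun n j => c n j ω) (N t) t, ?_, α, ⟨hα1, hα2⟩, ?_⟩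
  · intro t
    refine @Finset.measurable_fun_sum _ _ _ _ _ _ (_) _ _ fun n _ => ?_
    refine @Finset.measurable_fun_sum _ _ _ _ _ _ (_) _ _ fun j _ => ?_
    -- A step already started has a coefficient known at time `t`; a step not yet started
    -- contributes zero.
    by_cases hj : u n j ≤ t
    · have h0 : u n j ∈ Set.Icc 0 T :=
        ⟨(gridTime_nonneg hT n).trans (hu0 n ▸ hu n (Nat.zero_le j)), hj.trans t.2.2⟩
      exact @Measurable.mul_const _ _ _ _ _ (_) _ ((hc n j h0).mono (𝓕.mono hj) le_rfl) _
    · have : ∀ ω, c n j ω * (Set.Ico (u n j) (u n (j + 1))).indicator 1 (t : ℝ) = 0 := fun ω => by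
        rw [Set.indicator_of_notMem (fun h : (t : ℝ) ∈ Set.Ico _ _ => hj h.1), mul_zero]
      simp only [this]
      exact @measurable_const _ _ _ (_) _
  · filter_upwards [hKG, hX, hgood] with ω hω1 hω2 hω3
    have hψ : ∀ L s, s < gridTime T L → blockProcess M u (fun n j => c n j ω) (N s) s =
        blockProcess M u (fun n j => c n j ω) L s := fun L s hs =>
      blockProcess_eq_of_lt hT hu hu0 (hN s (hs.trans (gridTime_lt hT L))) hs
    have key := fun (t : ℝ) (ht : 0 ≤ t) (L : ℕ) (htL : t ≤ gridTime T L) =>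
      blockProcess_integral hT hu hu0 hω1 (hγ2.trans hH2).le (by linarith) (by linarith) hγ1 hψ
        ht htL
    refine ⟨fun t ht => ?_, ?_⟩
    · have h := key t ht.1 _ (hN t ht.2).le
      exact ⟨h.1, h.2.1⟩
    · refine tendsto_of_steering hT hω2 (fun n t ht => ?_) hω3
      rw [(key t ((gridTime_nonneg hT n).trans ht.1) (n + 1) ht.2).2.2, Finset.sum_range_succ]
      congr 1
      -- Blocks before `n` are complete at time `t`, so their integrals up to `t` are their full
      -- integrals, which add up to `I n`.
      have hsum : ∀ k, I k ω = ∑ i ∈ Finset.range k, stepIntegral (M i) (u i)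
          (fun j => c i j ω) (fun s => G s ω) (gridTime T (i + 1)) := by
        intro k
        induction k with
        | zero => simp [hI0]
        | succ k ih => rw [hI, ih, Finset.sum_range_succ]
      rw [hsum]
      refine Finset.sum_congr rfl fun i hi => ?_
      have hle : gridTime T (i + 1) ≤ t :=
        ((strictMono_gridTime hT).monotone (Finset.mem_range.1 hi)).trans ht.1
      rw [stepIntegral_of_ge (hu i) (by rw [huM]; exact hle),
        stepIntegral_of_ge (hu i) (huM i).le]
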